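/- Work in the real RAM model: a random access machine whose memory consists of arrays of natural numbers (used as indices) and arrays of real numbers, in which index operations, comparisons of real numbers and the exact real operations $+,-,\cdot,/,\sqrt{\ }$ each take one step, whose programs contain no real constants other than rational numbers, and which cannot convert (round) real numbers to integers. A *direction* is a unit vector of $\mathbb{R}^2$. A finite set $S\subset\mathbb{R}^2$ is in *$d$-general position* if no two points of $S$ lie on a line orthogonal to $d$. A geometric (straight-line) path is *$d$-monotone* if the orthogonal projections of its vertices on a line directed as $d$ are pairwise distinct and appear on this line in the order of the path or in the reverse order. For a set $\mathcal{D}$ of directions, a spanning tree $T$ of $S$ (a tree with vertex set $S$ and straight-line edges) is *$\mathcal{D}$-monotone* if for all vertices $u,v$ of $T$ there is a $d\in\mathcal{D}$ such that the path of $T$ between $u$ and $v$ is $d$-monotone. A *minimum $\mathcal{D}$-monotone spanning tree* of $S$ is a $\mathcal{D}$-monotone spanning tree of $S$ whose length (the sum of the Euclidean lengths of its edges) is minimum among all $\mathcal{D}$-monotone spanning trees of $S$. **Theorem.** There are a real RAM program and a constant $C$ such that the following holds for every $n\ge 1$, every set $S=\{p_1,\dots,p_n\}$ of $n$ distinct points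 in the plane, and every set $\mathcal{D}=\{d_1,d_2\}$ of two distinct, non-opposite directions such that $S$ is in $d_1$-general position and in $d_2$-general position: given the number $n$ and the coordinates of $p_1,\dots,p_n$, $d_1$ and $d_2$, the program halts after at most $C n^2$ steps and outputs the list of edges of a minimum $\mathcal{D}$-monotone spanning tree of $S$. That is, a minimum $\mathcal{D}$-monotone spanning tree of $n$ points can be computed in $O(n^2)$ time if $|\mathcal{D}|=2$. -/

import Mathlib

/-- The Euclidean plane. -/
abbrev Plane : Type := EuclideanSpace ℝ (Fin 2)

namespace MonotoneTree

/-- A direction is a vector from the origin to a point of the unit circle. -/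
def IsDirection (d : Plane) : Prop := ‖d‖ = 1

/-- The points `p v` are in `d`-general position: no two of them lie on a line orthogonal to `d`. -/
def GeneralPosition {V : Type*} (p : V → Plane) (d : Plane) : Prop :=
  ∀ u v : V, u ≠ v → inner ℝ d (p u - p v) ≠ 0

/-- The geometric path with vertex sequence `l` is `d`-monotone: the order of the projections of
its vertices on a line directed as `d` is the order along the path or the reverse of it.
(Strictness expresses that the vertices of the path are in `d`-general position.) -/
def PathMonotone {V : Type*} (p : V → Plane) (d : Plane) (l : List V) : Prop :=
  l.Pairwise (fun u v => inner ℝ d (p u) < inner ℝ d (p v)) ∨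
  l.Pairwise (fun u v => inner ℝ d (p v) < inner ℝ d (p u))

/-- `T` is a `D`-monotone spanning tree of the points `p v`: it is a tree on all of them, and for
all vertices `u`, `v` the path of `T` from `u` to `v` is `d`-monotone for some `d ∈ D`. -/
def IsMonotoneSpanningTree {V : Type*} (p : V → Plane) (D : Set Plane) (T : SimpleGraph V) :
    Prop :=
  T.IsTree ∧ ∀ (u v : V) (w : T.Walk u v), w.IsPath → ∃ d ∈ D, PathMonotone p d w.support

/-- The Euclidean length of a straight-line edge. -/
noncomputable def edgeLength {V : Type*} (p : V → Plane) : Sym2 V → ℝ :=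
  Sym2.lift ⟨fun u v => dist (p u) (p v), fun u v => dist_comm (p u) (p v)⟩

/-- The length of a geometric graph (used for finite `V`): the sum of its edge lengths. -/
noncomputable def graphLength {V : Type*} (p : V → Plane) (T : SimpleGraph V) : ℝ :=
  ∑ᶠ e ∈ T.edgeSet, edgeLength p e

/-- `T` is a minimum `D`-monotone spanning tree of the points `p v`. -/
def IsMinimumMonotoneSpanningTree {V : Type*} (p : V → Plane) (D : Set Plane)
    (T : SimpleGraph V) : Prop :=
  IsMonotoneSpanningTree p D T ∧
    ∀ T' : SimpleGraph V, IsMonotoneSpanningTree p D T' → graphLength p T ≤ graphLength p T'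

end MonotoneTree

/-! A real RAM: random access memory for natural numbers (indices) and for real numbers, exact
real arithmetic `+ - * / √` and real comparisons at unit cost, and no conversion of reals into
integers (no floor function). The memory is organized in arrays, of which a program uses finitely
many; array cells are addressed by computed indices. Index arithmetic is restricted to `± 1`, so
indices never exceed the input size, the literals of the program and the running time together. -/

namespace RealRAM

/-- The memory: `nat a i` and `real a i` are the cells with index `i` of the index array and of
the real array with name `a`. -/
structure Store where
  nat : ℕ → ℕ → ℕ
  real : ℕ → ℕ → ℝ

/-- Index expressions: literals, memory access, successor and (truncated) predecessor. -/
inductive NatExp where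
  | lit (k : ℕ)
  | get (a : ℕ) (i : NatExp)
  | succ (e : NatExp)
  | pred (e : NatExp)

/-- The value of an index expression. -/
def NatExp.eval (σ : Store) : NatExp → ℕ
  | .lit k => k
  | .get a i => σ.nat a (i.eval σ)
  | .succ e => e.eval σ + 1
  | .pred e => e.eval σ - 1

/-- The number of elementary operations in the evaluation. -/
def NatExp.cost : NatExp → ℕ
  | .lit _ => 1
  | .get _ i => i.cost + 1
  | .succ e => e.cost + 1
  | .pred e => e.cost + 1

/-- Real expressions. The only literals are rational numbers. -/
inductive RealExp where
  | lit (q : ℚ)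
  | get (a : ℕ) (i : NatExp)
  | add (e f : RealExp)
  | sub (e f : RealExp)
  | mul (e f : RealExp)
  | div (e f : RealExp)
  | sqrt (e : RealExp)

/-- The value of a real expression. Division by `0` and the square root of a negative number give
`0`; this adds no power, since a program can make the test itself at constant cost. -/
noncomputable def RealExp.eval (σ : Store) : RealExp → ℝ
  | .lit q => (q : ℝ)
  | .get a i => σ.real a (i.eval σ)
  | .add e f => e.eval σ + f.eval σ
  | .sub e f => e.eval σ - f.eval σ
  | .mul e f => e.eval σ * f.eval σ
  | .div e f => e.eval σ / f.eval σ
  | .sqrt e => Real.sqrt (e.eval σ)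

/-- The number of elementary operations in the evaluation. -/
def RealExp.cost : RealExp → ℕ
  | .lit _ => 1
  | .get _ i => i.cost + 1
  | .add e f => e.cost + f.cost + 1
  | .sub e f => e.cost + f.cost + 1
  | .mul e f => e.cost + f.cost + 1
  | .div e f => e.cost + f.cost + 1
  | .sqrt e => e.cost + 1

/-- Tests: comparisons of two indices or of two reals, and Boolean combinations. -/
inductive Test where
  | natLt (e f : NatExp)
  | realLt (e f : RealExp)
  | not (b : Test)
  | and (b c : Test)

/-- The test succeeds in the given memory. -/
def Test.Holds (σ : Store) : Test → Prop
  | .natLt e f => e.eval σ < f.eval σ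
  | .realLt e f => e.eval σ < f.eval σ
  | .not b => ¬ b.Holds σ
  | .and b c => b.Holds σ ∧ c.Holds σ

/-- The number of elementary operations in the evaluation. -/
def Test.cost : Test → ℕ
  | .natLt e f => e.cost + f.cost + 1
  | .realLt e f => e.cost + f.cost + 1
  | .not b => b.cost + 1
  | .and b c => b.cost + c.cost + 1

/-- Programs: assignments to a memory cell (array `a`, index `i`) and the usual control flow. -/
inductive Program where
  | skip
  | setNat (a : ℕ) (i e : NatExp)
  | setReal (a : ℕ) (i : NatExp) (e : RealExp)
  | seq (P Q : Program)
  | ite (b : Test) (P Q : Program)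
  | while (b : Test) (P : Program)

/-- The memory after writing the index `x` to cell `i` of the index array `a`. -/
def Store.writeNat (σ : Store) (a i x : ℕ) : Store :=
  { σ with nat := Function.update σ.nat a (Function.update (σ.nat a) i x) }

/-- The memory after writing the real `x` to cell `i` of the real array `a`. -/
noncomputable def Store.writeReal (σ : Store) (a i : ℕ) (x : ℝ) : Store :=
  { σ with real := Function.update σ.real a (Function.update (σ.real a) i x) }

/-- `Runs P σ τ t`: started with memory `σ`, the program `P` halts with memory `τ` after exactly
`t` steps. -/
inductive Runs : Program → Store → Store → ℕ → Prop where
  | skip (σ : Store) : Runs .skip σ σ 1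
  | setNat (σ : Store) (a : ℕ) (i e : NatExp) :
      Runs (.setNat a i e) σ (σ.writeNat a (i.eval σ) (e.eval σ)) (i.cost + e.cost + 1)
  | setReal (σ : Store) (a : ℕ) (i : NatExp) (e : RealExp) :
      Runs (.setReal a i e) σ (σ.writeReal a (i.eval σ) (e.eval σ)) (i.cost + e.cost + 1)
  | seq {P Q : Program} {σ ρ τ : Store} {s t : ℕ} :
      Runs P σ ρ s → Runs Q ρ τ t → Runs (.seq P Q) σ τ (s + t)
  | iteTrue {b : Test} {P Q : Program} {σ τ : Store} {t : ℕ} :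
      b.Holds σ → Runs P σ τ t → Runs (.ite b P Q) σ τ (b.cost + 1 + t)
  | iteFalse {b : Test} {P Q : Program} {σ τ : Store} {t : ℕ} :
      ¬ b.Holds σ → Runs Q σ τ t → Runs (.ite b P Q) σ τ (b.cost + 1 + t)
  | whileFalse {b : Test} {P : Program} {σ : Store} :
      ¬ b.Holds σ → Runs (.while b P) σ σ (b.cost + 1)
  | whileTrue {b : Test} {P : Program} {σ ρ τ : Store} {s t : ℕ} :
      b.Holds σ → Runs P σ ρ s → Runs (.while b P) ρ τ t →
      Runs (.while b P) σ τ (b.cost + 1 + s + t)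

end RealRAM

namespace MonotoneTree

/-- The input of the problem for `n` points and two directions. Index array `0` holds `n` in
cell `0`; real arrays `0` and `1` hold the first and second coordinates of the points; real array
`2` holds the coordinates of `d₁` and `d₂` in cells `0, 1, 2, 3`. All other cells are `0`. -/
noncomputable def inputStore {n : ℕ} (p : Fin n → Plane) (d₁ d₂ : Plane) : RealRAM.Store where
  nat := fun a i => if a = 0 ∧ i = 0 then n else 0
  real := fun a i =>
    match a with
    | 0 => if h : i < n then p ⟨i, h⟩ 0 else 0
    | 1 => if h : i < n then p ⟨i, h⟩ 1 else 0
    | 2 =>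
      match i with
      | 0 => d₁ 0
      | 1 => d₁ 1
      | 2 => d₂ 0
      | 3 => d₂ 1
      | _ => 0
    | _ => 0

/-- The graph on the `n` points that is read off the final memory: its edges are listed as the
`n - 1` pairs of point indices stored in cells `k < n - 1` of the index arrays `1` and `2`. -/
def outputGraph (n : ℕ) (τ : RealRAM.Store) : SimpleGraph (Fin n) :=
  SimpleGraph.fromRel (fun u v => ∃ k < n - 1, τ.nat 1 k = (u : ℕ) ∧ τ.nat 2 k = (v : ℕ))

end MonotoneTree

/-! Write `X` and `Y` for the projections on the two directions. Call a vertex `c` of a monotone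
tree an `X`-centre if `X` is monotone along every path of the tree that starts at `c`. The
structural key is `exists_isCenter`: every monotone tree has an `X`-centre or a `Y`-centre. If there
is no `Y`-centre, a vertex from which the largest number of vertices can be reached along
`X`-monotone paths is an `X`-centre; otherwise moving to the first turn of a non-monotone path would
reach strictly more.

Let `w` be an `X`-centre. Consider the vertices on one side of `w` in the order of `X`. The nearest
one is adjacent to `w`. If it is the only neighbour on that side, everything beyond it hangs off it
and the argument repeats there. If there is a second neighbour, every path arriving at `w` from that
side can be continued with a turn in `X`, so it must be `Y`-monotone; the side then consists of at
most two legs, one going down and one going up in `Y`. Hence the tree is a pair of legs, a path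
through consecutive points in the order of `X`, and a pair of legs (`Cand`). A pair of legs is
determined by its apex and the point set: with growing distance in `X`, each point must be a new
extreme in `Y` and is attached to the end that it surpasses (`leg`, `exists_leg`).

Conversely, every such tree is monotone: two points of the same pair of legs are joined by a
`Y`-monotone path, any other two points by an `X`-monotone one (`Cand.comp`). So it suffices to find
a shortest candidate for both choices of the leading direction
(`isMinimumMonotoneSpanningTree_of_cand`).

For a fixed second apex the two sides are optimized independently. A shortest half tree ending at
position `j` is either a shortest one ending at `j - 1` plus one edge, or the pair of legs with apex
at `j` (`half_cons`). Each pair of legs takes linear time, so `term_treeStep` costs O(n) and the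
total is O(n²). Sorting by counting ranks fits into the same bound. -/

namespace MonotoneTree

/-! ### Candidate trees and ascending paths -/

variable {V : Type*}

/-- The edges attaching the points of `l`, in this order, to the lower end `a` or the upper end `b`
of a `Y`-monotone path, if every point is a new extreme one. -/
noncomputable def leg (Y : V → ℝ) : List V → V → V → Option (List (V × V))
  | [], _, _ => some []
  | v :: l, a, b =>
    if Y v < Y a then (leg Y l v b).map ((v, a) :: ·)
    else if Y b < Y v then (leg Y l a v).map ((v, b) :: ·)
    else none

/-- The trees on the points of `l` (as edge lists) which consist of a pair of legs at a point and
of a path that continues to the head of `l`. -/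
inductive Half (Y : V → ℝ) : List V → List (V × V) → Prop
  | leg {c : V} {l : List V} {E : List (V × V)} (h : leg Y l c c = some E) : Half Y (c :: l) E
  | ext {a c : V} {l : List V} {E : List (V × V)} (h : Half Y (a :: l) E) :
      Half Y (c :: a :: l) (E ++ [(a, c)])

/-- The candidate trees (as edge lists) on the points of `l` with respect to the order of `l`:
a pair of legs, a path, a pair of legs. -/
def Cand (Y : V → ℝ) (l : List V) (E : List (V × V)) : Prop :=
  ∃ l₁ c r E₁ F, l = List.reverse l₁ ++ c :: r ∧ Half Y (c :: l₁) E₁ ∧ leg Y r c c = some F ∧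
    E = E₁ ++ F

/-- There is a path of `G` from `u` to `v` along which `f` increases. -/
def Asc (f : V → ℝ) (G : SimpleGraph V) : V → V → Prop :=
  Relation.ReflTransGen (fun u v => G.Adj u v ∧ f u < f v)

theorem Asc.neg {f : V → ℝ} {G : SimpleGraph V} {u v : V} (h : Asc (fun x => -f x) G u v) :
    Asc f G v u := by
  induction h with
  | refl => exact .refl
  | tail _ h ih => exact .head ⟨h.1.symm, by simpa using h.2⟩ ih

theorem Asc.le {f : V → ℝ} {G : SimpleGraph V} {u v : V} (h : Asc f G u v) : f u ≤ f v := by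
  induction h with
  | refl => exact le_rfl
  | tail _ h ih => exact ih.trans h.2.le

/-- Two vertices are joined by a path of `G` along which `f` is monotone. -/
def Comp (f : V → ℝ) (G : SimpleGraph V) (u v : V) : Prop := Asc f G u v ∨ Asc f G v u

/-! ### Candidates are monotone in one of the two directions between any two points -/

section leg

variable {Y : V → ℝ}

theorem leg_length {l : List V} {a b : V} {E : List (V × V)} (h : leg Y l a b = some E) :
    E.length = l.length := by
  induction l generalizing a b E with
  | nil => simp [leg] at h; simp [← h]
  | cons v l ih =>
    rw [leg] at h
    split_ifs at h
    all_goals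
      obtain ⟨F, hF, rfl⟩ := Option.map_eq_some_iff.1 h
      simp [ih hF]

theorem leg_ne {l : List V} {a b : V} {E : List (V × V)} (h : leg Y l a b = some E) :
    ∀ e ∈ E, e.1 ≠ e.2 := by
  induction l generalizing a b E with
  | nil => simp [leg] at h; simp [h]
  | cons v l ih =>
    rw [leg] at h
    split_ifs at h with h1 h2
    · obtain ⟨F, hF, rfl⟩ := Option.map_eq_some_iff.1 h
      simp only [List.mem_cons, forall_eq_or_imp]
      exact ⟨fun h => by simp [h] at h1, ih hF⟩
    · obtain ⟨F, hF, rfl⟩ := Option.map_eq_some_iff.1 h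
      simp only [List.mem_cons, forall_eq_or_imp]
      exact ⟨fun h => by simp [h] at h2, ih hF⟩

/-- The points in `W` are those already placed; they lie between `a` and `b` with respect to
ascending paths. A new point below `a` or above `b` prolongs these paths at one end, so
comparability survives. -/
theorem leg_comp {G : SimpleGraph V} {l : List V} {a b : V} {E : List (V × V)}
    (h : leg Y l a b = some E) (hE : ∀ e ∈ E, G.Adj e.1 e.2) (W : List V)
    (hW : ∀ u ∈ W, Asc Y G a u ∧ Asc Y G u b) (ha : a ∈ W) (hb : b ∈ W)
    (hc : ∀ u ∈ W, ∀ v ∈ W, Comp Y G u v) :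
    ∀ u ∈ l ++ W, ∀ v ∈ l ++ W, Comp Y G u v := by
  induction l generalizing a b E W with
  | nil => simpa using hc
  | cons v l ih =>
    rw [leg] at h
    split_ifs at h with h1 h2
    · obtain ⟨F, hF, rfl⟩ := Option.map_eq_some_iff.1 h
      simp only [List.mem_cons, forall_eq_or_imp] at hE
      have hv : Asc Y G v a := .single ⟨hE.1, h1⟩
      have hvW : ∀ u ∈ W, Asc Y G v u := fun u hu => hv.trans (hW u hu).1
      have := ih hF hE.2 (v :: W)
        (by
          simp only [List.mem_cons, forall_eq_or_imp]
          exact ⟨⟨.refl, hvW b hb⟩, fun u hu => ⟨hvW u hu, (hW u hu).2⟩⟩)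
        (by simp) (by simp [hb])
        (by
          simp only [List.mem_cons, forall_eq_or_imp]
          exact ⟨⟨.inl .refl, fun u hu => .inl (hvW u hu)⟩,
            fun u hu => ⟨.inr (hvW u hu), hc u hu⟩⟩)
      intro x hx y hy
      exact this x (by simp at hx ⊢; tauto) y (by simp at hy ⊢; tauto)
    · obtain ⟨F, hF, rfl⟩ := Option.map_eq_some_iff.1 h
      simp only [List.mem_cons, forall_eq_or_imp] at hE
      have hv : Asc Y G b v := .single ⟨hE.1.symm, h2⟩
      have hvW : ∀ u ∈ W, Asc Y G u v := fun u hu => (hW u hu).2.trans hv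
      have := ih hF hE.2 (v :: W)
        (by
          simp only [List.mem_cons, forall_eq_or_imp]
          exact ⟨⟨hvW a ha, .refl⟩, fun u hu => ⟨(hW u hu).1, hvW u hu⟩⟩)
        (by simp [ha]) (by simp)
        (by
          simp only [List.mem_cons, forall_eq_or_imp]
          exact ⟨⟨.inl .refl, fun u hu => .inr (hvW u hu)⟩,
            fun u hu => ⟨.inl (hvW u hu), hc u hu⟩⟩)
      intro x hx y hy
      exact this x (by simp at hx ⊢; tauto) y (by simp at hy ⊢; tauto)

/-- Points are attached in decreasing order of `f`, so the edge from a new point to the current end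
of a leg goes up in `f`, and from that end the ascent to `c` is already known. -/
theorem leg_asc {f : V → ℝ} {G : SimpleGraph V} {l : List V} {a b c : V} {E : List (V × V)}
    (h : leg Y l a b = some E) (hE : ∀ e ∈ E, G.Adj e.1 e.2)
    (hl : l.Pairwise (fun u v => f v < f u)) (hla : ∀ u ∈ l, f u < f a)
    (hlb : ∀ u ∈ l, f u < f b) (ha : Asc f G a c) (hb : Asc f G b c) :
    ∀ u ∈ l, Asc f G u c := by
  induction l generalizing a b E with
  | nil => simp
  | cons v l ih =>
    rw [leg] at h
    rw [List.pairwise_cons] at hl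
    simp only [List.mem_cons, forall_eq_or_imp] at hla hlb
    split_ifs at h with h1 h2
    · obtain ⟨F, hF, rfl⟩ := Option.map_eq_some_iff.1 h
      simp only [List.mem_cons, forall_eq_or_imp] at hE ⊢
      have hv : Asc f G v c := .head ⟨hE.1, hla.1⟩ ha
      exact ⟨hv, ih hF hE.2 hl.2 hl.1 hlb.2 hv hb⟩
    · obtain ⟨F, hF, rfl⟩ := Option.map_eq_some_iff.1 h
      simp only [List.mem_cons, forall_eq_or_imp] at hE ⊢
      have hv : Asc f G v c := .head ⟨hE.1, hlb.1⟩ hb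
      exact ⟨hv, ih hF hE.2 hl.2 hla.2 hl.1 ha hv⟩

theorem leg_self_comp {G : SimpleGraph V} {l : List V} {c : V} {E : List (V × V)}
    (h : leg Y l c c = some E) (hE : ∀ e ∈ E, G.Adj e.1 e.2) :
    ∀ u ∈ c :: l, ∀ v ∈ c :: l, Comp Y G u v := by
  have := leg_comp h hE [c] (by simp [Asc, Relation.ReflTransGen.refl]) (by simp) (by simp)
    (by simp [Comp, Asc, Relation.ReflTransGen.refl])
  intro u hu v hv
  exact this u (by simp at hu ⊢; tauto) v (by simp at hv ⊢; tauto)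

theorem leg_self_asc {f : V → ℝ} {G : SimpleGraph V} {l : List V} {c : V} {E : List (V × V)}
    (h : leg Y l c c = some E) (hE : ∀ e ∈ E, G.Adj e.1 e.2)
    (hl : (c :: l).Pairwise (fun u v => f v < f u)) :
    ∀ u ∈ c :: l, Asc f G u c := by
  rw [List.pairwise_cons] at hl
  simp only [List.mem_cons, forall_eq_or_imp]
  exact ⟨.refl, leg_asc h hE hl.2 hl.1 hl.1 .refl .refl⟩

end leg

namespace Half

variable {Y : V → ℝ}

theorem length {l : List V} {c : V} {E : List (V × V)} (h : Half Y (c :: l) E) :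
    E.length = l.length := by
  generalize hm : c :: l = m at h
  induction h generalizing c l with
  | leg h => obtain ⟨rfl, rfl⟩ := List.cons_eq_cons.1 hm; exact leg_length h
  | ext h ih => obtain ⟨rfl, rfl⟩ := List.cons_eq_cons.1 hm; simp [ih rfl]

theorem nonempty (l : List V) (c : V) : ∃ E, Half Y (c :: l) E := by
  induction l generalizing c with
  | nil => exact ⟨[], .leg rfl⟩
  | cons a l ih => obtain ⟨E, hE⟩ := ih a; exact ⟨_, .ext hE⟩

theorem ne {l : List V} {E : List (V × V)} (h : Half Y l E) (hl : l.Nodup) :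
    ∀ e ∈ E, e.1 ≠ e.2 := by
  induction h with
  | leg h => exact leg_ne h
  | ext h ih =>
    intro e he
    rw [List.mem_append, List.mem_singleton] at he
    rcases he with he | rfl
    · exact ih hl.of_cons e he
    · simp at hl; exact fun h => hl.1.1 h.symm

theorem asc {f : V → ℝ} {G : SimpleGraph V} {l : List V} {E : List (V × V)} (h : Half Y l E)
    (hE : ∀ e ∈ E, G.Adj e.1 e.2) (hl : l.Pairwise (fun u v => f v < f u)) :
    ∀ c ∈ l.head?, ∀ u ∈ l, Asc f G u c := by
  induction h with
  | leg h => simpa using leg_self_asc h hE hl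
  | @ext a c l E h ih =>
    simp only [List.mem_append, List.mem_singleton] at hE
    have h1 := ih (fun e he => hE e (.inl he)) (List.pairwise_cons.1 hl).2 a (by simp)
    have h2 : G.Adj a c := hE (a, c) (.inr rfl)
    have h3 : f a < f c := (List.pairwise_cons.1 hl).1 a (by simp)
    simp only [List.head?_cons, Option.mem_def, Option.some.injEq, forall_eq']
    intro u hu
    rcases List.mem_cons.1 hu with rfl | hu
    · exact .refl
    · exact (h1 u hu).tail ⟨h2, h3⟩

/-- Two points of the pair of legs are joined along `Y`. In every other case one of the points is
the head at some stage of the construction, and the other one ascends to it along `f`. -/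
theorem comp {f : V → ℝ} {G : SimpleGraph V} {l : List V} {E : List (V × V)} (h : Half Y l E)
    (hE : ∀ e ∈ E, G.Adj e.1 e.2) (hl : l.Pairwise (fun u v => f v < f u)) :
    ∀ u ∈ l, ∀ v ∈ l, Comp f G u v ∨ Comp Y G u v := by
  induction h with
  | leg h => exact fun u hu v hv => .inr (leg_self_comp h hE u hu v hv)
  | @ext a c l E h ih =>
    have h1 := (Half.ext (c := c) h).asc hE hl c (by simp)
    simp only [List.mem_append, List.mem_singleton] at hE
    have h2 := ih (fun e he => hE e (.inl he)) (List.pairwise_cons.1 hl).2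
    intro u hu v hv
    rcases List.mem_cons.1 hu with rfl | hu'
    · exact .inl (.inr (h1 v hv))
    · rcases List.mem_cons.1 hv with rfl | hv'
      · exact .inl (.inl (h1 u hu))
      · exact h2 u hu' v hv'

end Half

namespace Cand

variable {Y : V → ℝ}

theorem length {l : List V} {E : List (V × V)} (h : Cand Y l E) : E.length = l.length - 1 := by
  obtain ⟨l₁, c, r, E₁, F, rfl, h1, h2, rfl⟩ := h
  simp [h1.length, leg_length h2]

theorem nonempty {l : List V} (hl : l ≠ []) : ∃ E, Cand Y l E := by
  obtain ⟨E, hE⟩ := Half.nonempty (Y := Y) l.dropLast.reverse (l.getLast hl)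
  exact ⟨E ++ [], l.dropLast.reverse, l.getLast hl, [], E, [],
    by simp [List.dropLast_append_getLast], hE, rfl, rfl⟩

theorem ne {l : List V} {E : List (V × V)} (h : Cand Y l E) (hl : l.Nodup) :
    ∀ e ∈ E, e.1 ≠ e.2 := by
  obtain ⟨l₁, c, r, E₁, F, rfl, h1, h2, rfl⟩ := h
  have h3 : (c :: l₁).Nodup := by
    refine List.Sublist.nodup (l₂ := (l₁.reverse ++ c :: r).reverse) ?_ (List.nodup_reverse.2 hl)
    simp
  intro e he
  rcases List.mem_append.1 he with he | he
  · exact h1.ne h3 e he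
  · exact leg_ne h2 e he

/-- Paths between the two sides of `c` ascend in `f` through `c`. Pairs on the left side are settled
by `Half.comp`, pairs on the right side lie in one pair of legs. -/
theorem comp {f : V → ℝ} {G : SimpleGraph V} {l : List V} {E : List (V × V)} (h : Cand Y l E)
    (hE : ∀ e ∈ E, G.Adj e.1 e.2) (hl : l.Pairwise (fun u v => f u < f v)) :
    ∀ u ∈ l, ∀ v ∈ l, Comp f G u v ∨ Comp Y G u v := by
  obtain ⟨l₁, c, r, E₁, F, rfl, h1, h2, rfl⟩ := h
  simp only [List.mem_append] at hE
  rw [List.pairwise_append] at hl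
  have hl1 : (c :: l₁).Pairwise (fun u v => f v < f u) := by
    rw [List.pairwise_cons]
    refine ⟨fun a ha => hl.2.2 a (by simpa using ha) c (by simp), ?_⟩
    simpa [List.pairwise_reverse] using hl.1
  have k1 := h1.asc (fun e he => hE e (.inl he)) hl1 c (by simp)
  have k2 := h1.comp (fun e he => hE e (.inl he)) hl1
  have k3 := leg_self_comp h2 (fun e he => hE e (.inr he))
  -- The right side is the mirror image of the left one: apply the statement about legs to `-f`.
  have k4 : ∀ u ∈ c :: r, Asc f G c u := fun u hu =>
    (leg_self_asc (f := fun x => -f x) h2 (fun e he => hE e (.inr he)) (by simpa using hl.2.1)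
      u hu).neg
  have key : ∀ u, u ∈ l₁.reverse ++ c :: r → u ∈ c :: l₁ ∨ u ∈ c :: r := by
    intro u hu; simp at hu ⊢; tauto
  intro u hu v hv
  rcases key u hu with hu | hu <;> rcases key v hv with hv | hv
  · exact k2 u hu v hv
  · exact .inl (.inl ((k1 u hu).trans (k4 v hv)))
  · exact .inl (.inr ((k1 v hv).trans (k4 u hu)))
  · exact .inr (k3 u hu v hv)

end Cand

/-! ### Edge lists as trees -/

/-- The graph with the edges in `E`. -/
def listGraph (E : List (V × V)) : SimpleGraph V := SimpleGraph.fromRel (fun u v => (u, v) ∈ E)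

theorem listGraph_adj {E : List (V × V)} (hE : ∀ e ∈ E, e.1 ≠ e.2) :
    ∀ e ∈ E, (listGraph E).Adj e.1 e.2 := by
  intro e he
  rw [listGraph, SimpleGraph.fromRel_adj]
  exact ⟨hE e he, .inl he⟩

theorem listGraph_le {E : List (V × V)} {G : SimpleGraph V} (hE : ∀ e ∈ E, G.Adj e.1 e.2) :
    listGraph E ≤ G := by
  intro u v h
  rw [listGraph, SimpleGraph.fromRel_adj] at h
  rcases h.2 with h | h
  · exact hE _ h
  · exact (hE _ h).symm

theorem listGraph_edgeSet {E : List (V × V)} (hE : ∀ e ∈ E, e.1 ≠ e.2) :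
    (listGraph E).edgeSet = {x | x ∈ E.map (fun e => s(e.1, e.2))} := by
  ext x
  induction x with | _ u v
  simp only [SimpleGraph.mem_edgeSet, Set.mem_ofPred_eq, List.mem_map, listGraph,
    SimpleGraph.fromRel_adj]
  constructor
  · rintro ⟨-, h | h⟩
    · exact ⟨_, h, rfl⟩
    · exact ⟨_, h, Sym2.eq_swap⟩
  · rintro ⟨e, he, h⟩
    have := hE e he
    rcases Sym2.eq_iff.1 h with ⟨rfl, rfl⟩ | ⟨rfl, rfl⟩
    · exact ⟨this, .inl he⟩
    · exact ⟨this.symm, .inr he⟩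

theorem Asc.exists_walk {f : V → ℝ} {G : SimpleGraph V} {u v : V} (h : Asc f G u v) :
    ∃ w : G.Walk u v, w.support.Pairwise (fun a b => f a < f b) := by
  induction h using Relation.ReflTransGen.head_induction_on with
  | refl => exact ⟨.nil, by simp⟩
  | @head a c h _ ih =>
    obtain ⟨w, hw⟩ := ih
    refine ⟨.cons h.1 w, ?_⟩
    rw [SimpleGraph.Walk.support_cons, List.pairwise_cons]
    refine ⟨fun b hb => ?_, hw⟩
    rw [← SimpleGraph.Walk.cons_tail_support, List.mem_cons] at hb
    rcases hb with rfl | hb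
    · exact h.2
    · rw [← SimpleGraph.Walk.cons_tail_support, List.pairwise_cons] at hw
      exact h.2.trans (hw.1 b hb)

theorem Asc.pathMonotone {p : V → Plane} {d : Plane} {G : SimpleGraph V} (hG : G.IsTree) {u v : V}
    (h : Asc (fun x => inner ℝ d (p x)) G u v) (w : G.Walk u v) (hw : w.IsPath) :
    w.support.Pairwise (fun a b => (inner ℝ d (p a) : ℝ) < inner ℝ d (p b)) := by
  obtain ⟨w', h'⟩ := h.exists_walk
  have : w'.IsPath := by
    rw [SimpleGraph.Walk.isPath_def]
    exact h'.imp (fun h => by rintro rfl; exact lt_irrefl _ h)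
  rw [(hG.existsUnique_path u v).unique hw this]
  exact h'

theorem Comp.pathMonotone {p : V → Plane} {d : Plane} {G : SimpleGraph V} (hG : G.IsTree) {u v : V}
    (h : Comp (fun x => inner ℝ d (p x)) G u v) (w : G.Walk u v) (hw : w.IsPath) :
    PathMonotone p d w.support := by
  rcases h with h | h
  · exact .inl (h.pathMonotone hG w hw)
  · have := h.pathMonotone hG w.reverse hw.reverse
    rw [SimpleGraph.Walk.support_reverse, List.pairwise_reverse] at this
    exact .inr this

theorem Comp.reachable {f : V → ℝ} {G : SimpleGraph V} {u v : V} (h : Comp f G u v) :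
    G.Reachable u v := by
  rcases h with h | h
  · exact h.exists_walk.choose.reachable
  · exact h.exists_walk.choose.reachable.symm

/-- Comparability makes the graph connected, and a connected graph with at most `|V| - 1` edges is a
tree. There the ascending walk is the unique path between its ends. -/
theorem isMonotoneSpanningTree_of_comp [Finite V] [Nonempty V] {p : V → Plane} {d d' : Plane}
    {E : List (V × V)} (hE : ∀ e ∈ E, e.1 ≠ e.2) (hcard : E.length + 1 = Nat.card V)
    (h : ∀ u v, Comp (fun x => inner ℝ d (p x)) (listGraph E) u v ∨
      Comp (fun x => inner ℝ d' (p x)) (listGraph E) u v) :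
    IsMonotoneSpanningTree p {d, d'} (listGraph E) := by
  classical
  have hc : (listGraph E).Connected :=
    ⟨fun u v => (h u v).elim Comp.reachable Comp.reachable⟩
  have ht : (listGraph E).IsTree := by
    rw [SimpleGraph.isTree_iff_connected_and_card]
    refine ⟨hc, le_antisymm ?_ hc.card_vert_le_card_edgeSet_add_one⟩
    rw [← hcard, listGraph_edgeSet hE, ← List.coe_toFinset, Nat.card_coe_set_eq,
      Set.ncard_coe_finset]
    have := List.toFinset_card_le (E.map (fun e => s(e.1, e.2)))
    rw [List.length_map] at this
    lia
  refine ⟨ht, fun u v w hw => ?_⟩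
  rcases h u v with h | h
  · exact ⟨d, by simp, h.pathMonotone ht w hw⟩
  · exact ⟨d', by simp, h.pathMonotone ht w hw⟩

/-- The length of an edge list. -/
noncomputable def listLength (p : V → Plane) (E : List (V × V)) : ℝ :=
  (E.map (fun e => dist (p e.1) (p e.2))).sum

theorem listLength_append (p : V → Plane) (E F : List (V × V)) :
    listLength p (E ++ F) = listLength p E + listLength p F := by
  simp [listLength]

/-- The tree has as many edges as the list has entries, so no edge is listed twice and the two sums
agree. -/
theorem graphLength_listGraph [Finite V] {p : V → Plane} {E : List (V × V)}
    (hE : ∀ e ∈ E, e.1 ≠ e.2) (hcard : E.length + 1 = Nat.card V) (hT : (listGraph E).IsTree) :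
    graphLength p (listGraph E) = listLength p E := by
  classical
  have h1 := (SimpleGraph.isTree_iff_connected_and_card.1 hT).2
  rw [listGraph_edgeSet hE, ← List.coe_toFinset, Nat.card_coe_set_eq, Set.ncard_coe_finset,
    ← hcard] at h1
  have h2 : (E.map (fun e => s(e.1, e.2))).Nodup := by
    refine Multiset.coe_nodup.1 (Multiset.toFinset_card_eq_card_iff_nodup.1 ?_)
    rw [Multiset.coe_card, List.length_map]
    exact Nat.add_right_cancel h1
  rw [graphLength, listGraph_edgeSet hE, ← List.coe_toFinset, finsum_mem_coe_finset,
    List.sum_toFinset _ h2, List.map_map]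
  rfl

/-! ### Monotone sequences, turns, and concatenation of paths in a tree -/

/-- `f` increases or decreases along the list. -/
def MonoList (f : V → ℝ) (l : List V) : Prop :=
  l.Pairwise (fun u v => f u < f v) ∨ l.Pairwise (fun u v => f v < f u)

namespace MonoList

variable {f : V → ℝ} {l l' : List V}

theorem sublist (h : MonoList f l) (hl : l'.Sublist l) : MonoList f l' :=
  h.imp (·.sublist hl) (·.sublist hl)

theorem reverse (h : MonoList f l) : MonoList f l.reverse := by
  simpa [MonoList, List.pairwise_reverse] using Or.symm h

theorem neg (h : MonoList f l) : MonoList (fun x => -f x) l := by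
  simpa [MonoList] using Or.symm h

theorem singleton (f : V → ℝ) (u : V) : MonoList f [u] := by simp [MonoList]

theorem pair {u v : V} (h : f u ≠ f v) : MonoList f [u, v] := by
  simpa [MonoList] using lt_or_gt_of_ne h

/-- The common step from `b` to `c` forces both sequences to be monotone in the same sense. -/
theorem glue {b c x : V} {q : List V} (h : MonoList f (q ++ [b, c])) (h' : MonoList f [b, c, x]) :
    MonoList f (q ++ [b, c, x]) := by
  simp only [MonoList, List.pairwise_append, List.pairwise_cons, List.mem_cons] at *
  simp only [List.not_mem_nil, or_false, forall_eq_or_imp, forall_eq] at *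
  rcases h with h | h <;> rcases h' with h' | h'
  · refine .inl ⟨h.1, h', fun a ha => ?_⟩
    have := h.2.2 a ha
    exact ⟨this.1, this.2, this.2.trans h'.2.1⟩
  · exact absurd h.2.1.1 (not_lt.2 h'.1.1.le)
  · exact absurd h.2.1.1 (not_lt.2 h'.1.1.le)
  · refine .inr ⟨h.1, h', fun a ha => ?_⟩
    have := h.2.2 a ha
    exact ⟨this.1, this.2, h'.2.1.trans this.2⟩

/-- A list along which `f` is not monotone has a first turn. -/
theorem exists_turn (hf : Function.Injective f) (hl : l.Nodup) (h : ¬ MonoList f l) :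
    ∃ q b c x q', l = q ++ b :: c :: x :: q' ∧ MonoList f (q ++ [b, c]) ∧
      ¬ MonoList f [b, c, x] := by
  induction l using List.reverseRecOn with
  | nil => exact absurd (by simp [MonoList]) h
  | append_singleton l x ih =>
    by_cases h' : MonoList f l
    · rcases List.eq_nil_or_concat l with rfl | ⟨l, c, rfl⟩
      · exact absurd (singleton f x) h
      rcases List.eq_nil_or_concat l with rfl | ⟨l, b, rfl⟩
      · refine absurd (pair (f := f) (u := c) (v := x) ?_) h
        simp at hl
        exact fun h => hl (hf h)
      · refine ⟨l, b, c, x, [], by simp, by simpa using h', fun h2 => h ?_⟩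
        simpa using glue (by simpa using h') h2
    · obtain ⟨q, b, c, y, q', rfl, h1, h2⟩ := ih (List.nodup_append.1 hl).1 h'
      exact ⟨q, b, c, y, q' ++ [x], by simp, h1, h2⟩

end MonoList

/-- The list is the sequence of the vertices of a path. -/
def TPath (T : SimpleGraph V) (l : List V) : Prop := l.IsChain T.Adj ∧ l.Nodup

/-- No step of the sequence is reversed immediately. -/
def NoBacktrack : List V → Prop
  | a :: b :: c :: l => a ≠ c ∧ NoBacktrack (b :: c :: l)
  | _ => True

theorem NoBacktrack.of_nodup {l : List V} (h : l.Nodup) : NoBacktrack l := by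
  induction l with
  | nil => trivial
  | cons a l ih =>
    match l, h, ih with
    | [], _, _ => trivial
    | [b], _, _ => trivial
    | b :: c :: l, h, ih =>
      refine ⟨?_, ih h.of_cons⟩
      simp at h
      exact h.1.2.1

theorem NoBacktrack.append {l l' : List V} {b c d : V} (h : NoBacktrack (l ++ [b, c]))
    (h' : NoBacktrack (c :: d :: l')) (hbd : b ≠ d) : NoBacktrack (l ++ b :: c :: d :: l') := by
  induction l with
  | nil => exact ⟨hbd, h'⟩
  | cons x l ih =>
    match l, h, ih with
    | [], h, ih => exact ⟨h.1, ih trivial⟩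
    | [y], h, ih => exact ⟨h.1, ih h.2⟩
    | y :: z :: l, h, ih => exact ⟨h.1, ih h.2⟩

theorem isChain_edges_of_noBacktrack {T : SimpleGraph V} {u v : V} (w : T.Walk u v)
    (h : NoBacktrack w.support) : w.edges.IsChain (· ≠ ·) := by
  induction w with
  | nil => simp
  | @cons u x v hux w ih =>
    cases w with
    | nil => simp
    | @cons _ y _ hxy w =>
      simp only [SimpleGraph.Walk.support_cons, SimpleGraph.Walk.edges_cons] at h ih ⊢
      rw [← SimpleGraph.Walk.cons_tail_support] at h ih
      rw [List.isChain_cons_cons]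
      refine ⟨fun he => ?_, ih h.2⟩
      rcases Sym2.eq_iff.1 he with ⟨rfl, -⟩ | ⟨h1, -⟩
      · exact hux.ne rfl
      · exact h.1 h1

/-- A walk without immediate reversals in an acyclic graph is a path. This reduces the concatenation
of paths in `TPath.append` to one inequality at the junction. -/
theorem nodup_of_noBacktrack {T : SimpleGraph V} (hT : T.IsAcyclic) {l : List V}
    (h : l.IsChain T.Adj) (h' : NoBacktrack l) : l.Nodup := by
  by_cases hl : l = []
  · simp [hl]
  have : (SimpleGraph.Walk.ofSupport l hl h).IsPath := by
    rw [hT.isPath_iff_isChain]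
    apply isChain_edges_of_noBacktrack
    rwa [SimpleGraph.Walk.support_ofSupport]
  rw [← SimpleGraph.Walk.support_ofSupport hl h]
  exact this.support_nodup

namespace TPath

variable {T : SimpleGraph V}

theorem of_infix {l l' : List V} (h : TPath T l) (hl : l' <:+: l) : TPath T l' :=
  ⟨h.1.infix hl, h.2.sublist hl.sublist⟩

theorem reverse {l : List V} (h : TPath T l) : TPath T l.reverse := by
  refine ⟨?_, List.nodup_reverse.2 h.2⟩
  rw [List.isChain_reverse]
  exact h.1.imp fun a b h => h.symm

theorem pair {u v : V} (h : T.Adj u v) : TPath T [u, v] := by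
  simp [TPath, h, h.ne]

theorem append (hT : T.IsAcyclic) {l l' : List V} {b c d : V} (h : TPath T (l ++ [b, c]))
    (h' : TPath T (c :: d :: l')) (hbd : b ≠ d) : TPath T (l ++ b :: c :: d :: l') := by
  have h1 : (l ++ b :: c :: d :: l').IsChain T.Adj := by
    have := h.1
    have h2 := h'.1
    simp [List.isChain_append] at this h2 ⊢
    tauto
  exact ⟨h1, nodup_of_noBacktrack hT h1 ((NoBacktrack.of_nodup h.2).append (.of_nodup h'.2) hbd)⟩

theorem exists_of_isTree (hT : T.IsTree) (u v : V) :
    ∃ l, TPath T (u :: l) ∧ (u :: l).getLast? = some v := by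
  obtain ⟨w, hw, -⟩ := hT.existsUnique_path u v
  refine ⟨w.support.tail, ?_⟩
  rw [SimpleGraph.Walk.cons_tail_support]
  refine ⟨⟨w.isChain_adj_support, hw.support_nodup⟩, ?_⟩
  rw [List.getLast?_eq_some_getLast w.support_ne_nil, SimpleGraph.Walk.getLast_support]

theorem unique (hT : T.IsTree) {l l' : List V} (h : TPath T l) (h' : TPath T l')
    (h1 : l.head? = l'.head?) (h2 : l.getLast? = l'.getLast?) : l = l' := by
  by_cases hl : l = []
  · subst hl; simpa using h1.symm
  have hl' : l' ≠ [] := by rintro rfl; simp at h1; exact hl h1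
  have e1 : l.head hl = l'.head hl' := by
    rw [List.head?_eq_some_head hl, List.head?_eq_some_head hl'] at h1; simpa using h1
  have e2 : l.getLast hl = l'.getLast hl' := by
    rw [List.getLast?_eq_some_getLast hl, List.getLast?_eq_some_getLast hl'] at h2; simpa using h2
  have p1 : (SimpleGraph.Walk.ofSupport l hl h.1).IsPath := by
    rw [SimpleGraph.Walk.isPath_def, SimpleGraph.Walk.support_ofSupport]; exact h.2
  have p2 : ((SimpleGraph.Walk.ofSupport l' hl' h'.1).copy e1.symm e2.symm).IsPath := by
    rw [SimpleGraph.Walk.isPath_def, SimpleGraph.Walk.support_copy,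
      SimpleGraph.Walk.support_ofSupport]
    exact h'.2
  have := congrArg SimpleGraph.Walk.support ((hT.existsUnique_path _ _).unique p1 p2)
  rwa [SimpleGraph.Walk.support_copy, SimpleGraph.Walk.support_ofSupport,
    SimpleGraph.Walk.support_ofSupport] at this

end TPath

/-! ### Existence of a centre -/

/-- `f` is monotone along all paths from `c`. -/
def IsCenter (f : V → ℝ) (T : SimpleGraph V) (c : V) : Prop :=
  ∀ q, TPath T (c :: q) → MonoList f (c :: q)

section center

variable {T : SimpleGraph V} {X Y : V → ℝ}

/-- Every path from `c` can be prolonged backwards by a piece that spoils `X`: by `b` if the path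
leaves towards `x`, because of the turn at `c`, and otherwise by the reverse of `c, x, r`. The
prolonged path must then be `Y`-monotone. -/
theorem isCenter_of_turns (hT : T.IsAcyclic)
    (H : ∀ l, TPath T l → MonoList X l ∨ MonoList Y l) {b c x : V} {r : List V}
    (hp : TPath T (b :: c :: x :: r)) (h : ¬ MonoList X [b, c, x])
    (h' : ¬ MonoList X (c :: x :: r)) : IsCenter Y T c := by
  intro q hq
  rcases q with _ | ⟨d, q⟩
  · exact .singleton Y c
  by_cases hd : d = x
  · subst hd
    have hbd : b ≠ d := by have := hp.2; simp at this; exact this.1.2.1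
    have h1 : TPath T (b :: c :: d :: q) :=
      TPath.append (l := []) hT (hp.of_infix ⟨[], d :: r, by simp⟩) hq hbd
    rcases H _ h1 with h2 | h2
    · exact absurd (h2.sublist (by simp)) h
    · exact h2.sublist (by simp)
  · have h1 : TPath T (r.reverse ++ [x, c]) := by
      have := (hp.of_infix (l' := c :: x :: r) ⟨[b], [], by simp⟩).reverse
      simpa using this
    have h2 := TPath.append hT h1 hq (Ne.symm hd)
    rcases H _ h2 with h3 | h3
    · refine absurd (h3.sublist (l' := r.reverse ++ [x, c]) (by simp)).reverse ?_
      simpa using h'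
    · exact h3.sublist (by simp)

theorem exists_isCenter [Finite V] [Nonempty V] (hT : T.IsTree) (hX : Function.Injective X)
    (H : ∀ l, TPath T l → MonoList X l ∨ MonoList Y l) :
    (∃ c, IsCenter X T c) ∨ ∃ c, IsCenter Y T c := by
  by_contra! hno
  obtain ⟨hnX, hnY⟩ := hno
  -- The vertices reachable from `w` along an `X`-monotone path; `w` is chosen with this set of
  -- maximum size.
  let S : V → Set V := fun w =>
    {u | ∃ l, TPath T (w :: l) ∧ (w :: l).getLast? = some u ∧ MonoList X (w :: l)}
  obtain ⟨w, hw⟩ := Finite.exists_max (fun w => (S w).ncard)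
  have := hnX w
  simp only [IsCenter] at this
  push Not at this
  obtain ⟨q, hq, hq'⟩ := this
  obtain ⟨q₀, b, c, x, q₁, he, h1, h2⟩ := MonoList.exists_turn hX hq.2 hq'
  rw [he] at hq
  have hhead : ∀ r, (q₀ ++ b :: r).head? = some w := by
    intro r
    rcases q₀ with _ | ⟨y, q₀⟩ <;> simp at he <;> simp [he.1]
  have hbx : b ≠ x := by have := (List.nodup_append.1 hq.2).2.1; simp at this; exact this.1.2.1
  have hcx : T.Adj c x := by
    have := (hq.of_infix (l' := [c, x]) ⟨q₀ ++ [b], q₁, by simp⟩).1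
    simpa using this
  -- If the path from `c` to `u` avoids `b`, it is the final part of the path from `w` to `u`, hence
  -- monotone. If it starts with `b`, prefixing `x` creates a turn at `c`, so a failure of
  -- monotonicity would make `c` a `Y`-centre.
  have hsub : S w ⊆ S c := by
    rintro u ⟨l, hl, hu, hm⟩
    obtain ⟨q', hq1, hq2⟩ := TPath.exists_of_isTree hT c u
    refine ⟨q', hq1, hq2, ?_⟩
    rcases q' with _ | ⟨d, q'⟩
    · exact .singleton X c
    by_cases hd : d = b
    · subst hd
      by_contra hcon
      refine hnY c (isCenter_of_turns hT.isAcyclic H (b := x) (x := d) (r := q') ?_ ?_ hcon)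
      · exact TPath.append (l := []) hT.isAcyclic (TPath.pair hcx.symm) hq1 hbx.symm
      · exact fun h => h2 (by simpa using h.reverse)
    · have h3 : TPath T (q₀ ++ b :: c :: d :: q') :=
        TPath.append hT.isAcyclic (hq.of_infix ⟨[], x :: q₁, by simp⟩) hq1 (Ne.symm hd)
      have h4 := TPath.unique hT h3 hl (by rw [hhead]; simp) (by
        rw [hu, ← hq2, List.getLast?_append]
        simp [List.getLast?_eq_some_getLast (List.cons_ne_nil d q')])
      rw [← h4] at hm
      exact hm.sublist (by simp)
  have hx : x ∈ S c := ⟨[x], TPath.pair hcx, by simp, .pair (fun h => hcx.ne (hX h))⟩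
  have hxw : x ∉ S w := by
    rintro ⟨l, hl, hu, hm⟩
    have h3 : TPath T (q₀ ++ [b, c, x]) := hq.of_infix ⟨[], q₁, by simp⟩
    have h4 := TPath.unique hT h3 hl (by rw [hhead]; simp) (by rw [hu]; simp)
    rw [← h4] at hm
    exact h2 (hm.sublist (by simp))
  -- The vertex `x` just after the first turn is gained, contradicting the choice of `w`.
  have : S w ⊂ S c := ⟨hsub, fun h => hxw (h hx)⟩
  exact absurd (hw c) (not_le.2 (Set.ncard_lt_ncard this (Set.toFinite _)))

/-! ### The shape of a monotone tree with a centre -/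

theorem Asc.of_list {f : V → ℝ} {l : List V} {u v : V} (h : (u :: l).IsChain T.Adj)
    (h' : (u :: l).Pairwise (fun a b => f a < f b)) (hv : (u :: l).getLast? = some v) :
    Asc f T u v := by
  induction l generalizing u with
  | nil => simp at hv; subst hv; exact .refl
  | cons x l ih =>
    rw [List.isChain_cons_cons] at h
    rw [List.pairwise_cons] at h'
    exact .head ⟨h.1, h'.1 x (by simp)⟩ (ih h.2 h'.2 (by simpa using hv))

theorem Asc.exists_list {f : V → ℝ} {u v : V} (h : Asc f T u v) :
    ∃ l, (u :: l).IsChain T.Adj ∧ (u :: l).Pairwise (fun a b => f a < f b) ∧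
      (u :: l).getLast? = some v := by
  obtain ⟨w, hw⟩ := h.exists_walk
  refine ⟨w.support.tail, ?_⟩
  rw [SimpleGraph.Walk.cons_tail_support]
  refine ⟨w.isChain_adj_support, hw, ?_⟩
  rw [List.getLast?_eq_some_getLast w.support_ne_nil, SimpleGraph.Walk.getLast_support]

theorem IsCenter.comp (hT : T.IsTree) {c : V} (h : IsCenter X T c) (u : V) : Comp X T c u := by
  obtain ⟨l, hl, hu⟩ := TPath.exists_of_isTree hT c u
  rcases h l hl with h | h
  · exact .inl (.of_list hl.1 h hu)
  · refine .inr (Asc.neg (.of_list hl.1 ?_ hu))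
    simpa using h

/-- There is a path of `G` from `u` to `v` along which `f` and `g` increase. -/
def Asc₂ (f g : V → ℝ) (G : SimpleGraph V) : V → V → Prop :=
  Relation.ReflTransGen (fun u v => G.Adj u v ∧ f u < f v ∧ g u < g v)

theorem Asc₂.fst {f g : V → ℝ} {u v : V} (h : Asc₂ f g T u v) : Asc f T u v :=
  Relation.ReflTransGen.mono (fun _ _ (h : _ ∧ _ ∧ _) => ⟨h.1, h.2.1⟩) _ _ h

theorem Asc₂.snd {f g : V → ℝ} {u v : V} (h : Asc₂ f g T u v) : Asc g T u v :=
  Relation.ReflTransGen.mono (fun _ _ (h : _ ∧ _ ∧ _) => ⟨h.1, h.2.2⟩) _ _ h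

theorem Asc₂.of_list {f g : V → ℝ} {l : List V} {u v : V} (h : (u :: l).IsChain T.Adj)
    (h' : (u :: l).Pairwise (fun a b => f a < f b))
    (h'' : (u :: l).Pairwise (fun a b => g a < g b)) (hv : (u :: l).getLast? = some v) :
    Asc₂ f g T u v := by
  induction l generalizing u with
  | nil => simp at hv; subst hv; exact .refl
  | cons x l ih =>
    rw [List.isChain_cons_cons] at h
    rw [List.pairwise_cons] at h' h''
    exact .head ⟨h.1, h'.1 x (by simp), h''.1 x (by simp)⟩ (ih h.2 h'.2 h''.2 (by simpa using hv))

/-- Continue the ascent from `u` through `s` to `w` by the step down to `n`. This path turns in `X`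
at `w`, so it is `Y`-monotone, and its step from `s` to `w` shows in which sense. -/
theorem asc₂_of_turn (hT : T.IsAcyclic) (H : ∀ l, TPath T l → MonoList X l ∨ MonoList Y l)
    {u s n w : V} (hs : T.Adj s w) (hs' : X s < X w) (hn : T.Adj n w) (hn' : X n < X w)
    (hsn : s ≠ n) (hY : Y s < Y w) (hu : Asc X T u s) : Asc₂ X Y T u w := by
  obtain ⟨l, h1, h2, h3⟩ := hu.exists_list
  obtain ⟨m, hm⟩ : ∃ m, u :: l = m ++ [s] := by
    rw [List.getLast?_eq_some_iff] at h3; exact h3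
  obtain ⟨l', hl'⟩ : ∃ l', u :: l' = m ++ [s, w] := by
    rcases m with _ | ⟨y, m⟩ <;> simp at hm <;> simp [hm.1]
  have c1 : (m ++ [s, w]).IsChain T.Adj := by
    rw [hm] at h1
    simp [List.isChain_append] at h1 ⊢
    tauto
  have c2 : (m ++ [s, w]).Pairwise (fun a b => X a < X b) := by
    rw [hm] at h2
    simp [List.pairwise_append] at h2 ⊢
    exact ⟨h2.1, hs', fun a ha => ⟨h2.2 a ha, (h2.2 a ha).trans hs'⟩⟩
  have c3 : TPath T (m ++ [s, w]) := ⟨c1, c2.imp fun h => by rintro rfl; exact lt_irrefl _ h⟩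
  have c4 : TPath T (m ++ [s, w, n]) := c3.append hT (TPath.pair hn.symm) hsn
  rcases H _ c4 with h | h
  · have := h.sublist (l' := [s, w, n]) (by simp)
    simp [MonoList] at this
    rcases this with h | h <;> linarith [h.1.1, h.2]
  · have h4 : MonoList Y (m ++ [s, w]) := h.sublist (by simp)
    rw [← hl'] at c1 c2 h4
    have h5 : (u :: l').getLast? = some w := by rw [hl']; simp
    rcases h4 with h4 | h4
    · exact .of_list c1 c2 h4 h5
    · rw [hl'] at h4
      simp [List.pairwise_append] at h4
      exact absurd h4.2.1 (not_lt.2 hY.le)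

/-- Otherwise the path `s, w, n` would turn at `w` in both directions. -/
theorem adj_unique (hT : T.IsAcyclic) (H : ∀ l, TPath T l → MonoList X l ∨ MonoList Y l)
    {s n w : V} (hs : T.Adj s w) (hs' : X s < X w) (hn : T.Adj n w) (hn' : X n < X w)
    (hY : Y s < Y w) (hY' : Y n < Y w) : s = n := by
  by_contra hsn
  have : TPath T [s, w, n] := TPath.append (l := []) hT (TPath.pair hs) (TPath.pair hn.symm) hsn
  rcases H _ this with h | h <;> simp [MonoList] at h <;>
    rcases h with h | h <;> linarith [h.1.1, h.2]

/-- The tree leaves the greedy construction no choice. `W` is the set of visited vertices, `a` and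
`b` are the ends of the legs; `ha` and `hb` say that every visited vertex of a leg other than its
end already has its next vertex in `W`. The apex `w` belongs to both legs. -/
theorem exists_leg {w : V}
    (hsplit : ∀ u, Asc X T u w → Asc₂ X Y T u w ∨ Asc₂ X (fun x => -Y x) T u w)
    (hU : ∀ v s n, T.Adj s v → X s < X v → T.Adj n v → X n < X v → Y s < Y v → Y n < Y v → s = n)
    (hU' : ∀ v s n, T.Adj s v → X s < X v → T.Adj n v → X n < X v → Y v < Y s → Y v < Y n → s = n)
    (l : List V) (W : Set V) (a b : V) (hw : w ∈ W)
    (hl : l.Pairwise (fun u v => X v < X u)) (hlW : ∀ u ∈ W, ∀ v ∈ l, X v < X u)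
    (hmem : ∀ u, u ∈ l ∨ u ∈ W ↔ Asc X T u w)
    (ha : ∀ u ∈ W, Asc₂ X Y T u w → u ≠ a → ∃ s ∈ W, T.Adj s u ∧ X s < X u ∧ Y s < Y u)
    (hb : ∀ u ∈ W, Asc₂ X (fun x => -Y x) T u w → u ≠ b →
      ∃ s ∈ W, T.Adj s u ∧ X s < X u ∧ Y u < Y s)
    (haw : Y a ≤ Y w) (hwb : Y w ≤ Y b) :
    ∃ E, leg Y l a b = some E ∧ ∀ e ∈ E, T.Adj e.1 e.2 := by
  induction l generalizing W a b with
  | nil => exact ⟨[], rfl, by simp⟩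
  | cons v l ih =>
    have hl1 := List.pairwise_cons.1 hl
    have hvw : v ≠ w := by rintro rfl; exact lt_irrefl _ (hlW v hw v (by simp))
    -- The vertices come in decreasing order of `X`, so the next vertex on the way from `v` up to
    -- `w` has been visited.
    have hvis : ∀ v', X v < X v' → Asc X T v' w → v' ∈ W := by
      intro v' h1 h2
      rcases (hmem v').2 h2 with h3 | h3
      · rcases List.mem_cons.1 h3 with rfl | h3
        · exact absurd h1 (lt_irrefl _)
        · exact absurd h1 (not_lt.2 (hl1.1 v' h3).le)
      · exact h3
    have hmem' : ∀ u, u ∈ l ∨ u ∈ insert v W ↔ Asc X T u w := by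
      intro u
      rw [← hmem u, List.mem_cons, Set.mem_insert_iff]
      tauto
    have hlW' : ∀ u ∈ insert v W, ∀ v' ∈ l, X v' < X u := by
      rintro u (rfl | hu) v' hv'
      · exact hl1.1 v' hv'
      · exact hlW u hu v' (by simp [hv'])
    rcases hsplit v ((hmem v).1 (.inl (by simp))) with h | h
    · rcases Relation.ReflTransGen.cases_head h with rfl | ⟨v', ⟨h1, h2, h3⟩, h4⟩
      · exact absurd rfl hvw
      change Asc₂ X Y T v' w at h4
      have hv' := hvis v' h2 h4.fst
      -- If `v'` were not the end of its leg, its next vertex `s` in `W` and the new vertex `v`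
      -- would both be lower neighbours of `v'` on the same side in `Y`.
      have hv'a : v' = a := by
        by_contra hne
        obtain ⟨s, hs, hs1, hs2, hs3⟩ := ha v' hv' h4 hne
        have := hU v' s v hs1 hs2 h1 h2 hs3 h3
        subst this
        exact lt_irrefl _ (hlW s hs s (by simp))
      subst hv'a
      obtain ⟨E, hE, hE'⟩ := ih (insert v W) v b (.inr hw) hl1.2 hlW' hmem'
        (by
          rintro u (rfl | hu) hu1 hu2
          · exact absurd rfl hu2
          · by_cases hua : u = v'
            · subst hua; exact ⟨v, .inl rfl, h1, h2, h3⟩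
            · obtain ⟨s, hs, hs'⟩ := ha u hu hu1 hua
              exact ⟨s, .inr hs, hs'⟩)
        (by
          rintro u (rfl | hu) hu1 hu2
          · have := hu1.snd.le; simp at this; linarith
          · obtain ⟨s, hs, hs'⟩ := hb u hu hu1 hu2
            exact ⟨s, .inr hs, hs'⟩)
        (h3.le.trans haw) hwb
      refine ⟨(v, v') :: E, by rw [leg, if_pos h3, hE]; rfl, ?_⟩
      simp only [List.mem_cons, forall_eq_or_imp]
      exact ⟨h1, hE'⟩
    · rcases Relation.ReflTransGen.cases_head h with rfl | ⟨v', ⟨h1, h2, h3⟩, h4⟩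
      · exact absurd rfl hvw
      change Asc₂ X (fun x => -Y x) T v' w at h4
      replace h3 : Y v' < Y v := by simpa using h3
      have hv' := hvis v' h2 h4.fst
      have hv'b : v' = b := by
        by_contra hne
        obtain ⟨s, hs, hs1, hs2, hs3⟩ := hb v' hv' h4 hne
        have := hU' v' s v hs1 hs2 h1 h2 hs3 h3
        subst this
        exact lt_irrefl _ (hlW s hs s (by simp))
      subst hv'b
      obtain ⟨E, hE, hE'⟩ := ih (insert v W) a v (.inr hw) hl1.2 hlW' hmem'
        (by
          rintro u (rfl | hu) hu1 hu2
          · have := hu1.snd.le; linarith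
          · obtain ⟨s, hs, hs'⟩ := ha u hu hu1 hu2
            exact ⟨s, .inr hs, hs'⟩)
        (by
          rintro u (rfl | hu) hu1 hu2
          · exact absurd rfl hu2
          · by_cases hua : u = v'
            · subst hua; exact ⟨v, .inl rfl, h1, h2, h3⟩
            · obtain ⟨s, hs, hs'⟩ := hb u hu hu1 hua
              exact ⟨s, .inr hs, hs'⟩)
        haw (hwb.trans h3.le)
      refine ⟨(v, v') :: E, ?_, ?_⟩
      -- The first test of `leg` fails because `Y a ≤ Y w ≤ Y b < Y v`.
      · rw [leg, if_neg (by linarith), if_pos h3, hE]; rfl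
      · simp only [List.mem_cons, forall_eq_or_imp]
        exact ⟨h1, hE'⟩

/-- The number of lower neighbours of `w` decides: with a second one, all of `l` forms a pair of
legs at `w`; with only one, the edge to it belongs to the path and the induction moves there. -/
theorem exists_half (hT : T.IsAcyclic) (H : ∀ l, TPath T l → MonoList X l ∨ MonoList Y l)
    (hY : Function.Injective Y) (l : List V) (w : V)
    (hl : (w :: l).Pairwise (fun u v => X v < X u))
    (hmem : ∀ u, u ∈ l ↔ Asc X T u w ∧ u ≠ w) :
    ∃ E, Half Y (w :: l) E ∧ ∀ e ∈ E, T.Adj e.1 e.2 := by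
  induction l generalizing w with
  | nil => exact ⟨[], .leg rfl, by simp⟩
  | cons a l ih =>
    have hl1 := List.pairwise_cons.1 hl
    have hl2 := List.pairwise_cons.1 hl1.2
    have haw := hl1.1 a (by simp)
    have hlast : ∀ u, Asc X T u w → u ≠ w → ∃ s, Asc X T u s ∧ T.Adj s w ∧ X s < X w := by
      intro u hu hne
      rcases Relation.ReflTransGen.cases_tail hu with rfl | ⟨s, h1, h2⟩
      · exact absurd rfl hne
      · exact ⟨s, h1, h2⟩
    have hin : ∀ s, T.Adj s w → X s < X w → s ∈ a :: l := fun s h1 h2 =>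
      (hmem s).2 ⟨.single ⟨h1, h2⟩, h1.ne⟩
    -- The last vertex before `w` on the ascent from `a` is at least as high as `a`, and `a` is the
    -- highest vertex of the list.
    have haadj : T.Adj a w := by
      obtain ⟨s, h1, h2, h3⟩ := hlast a ((hmem a).1 (by simp)).1 ((hmem a).1 (by simp)).2
      rcases List.mem_cons.1 (hin s h2 h3) with rfl | hs
      · exact h2
      · exact absurd h1.le (not_le.2 (hl2.1 s hs))
    by_cases hn : ∃ n, n ≠ a ∧ T.Adj n w ∧ X n < X w
    · obtain ⟨n, hna, hn1, hn2⟩ := hn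
      have H' : ∀ l, TPath T l → MonoList X l ∨ MonoList (fun x => -Y x) l := fun l hl =>
        (H l hl).imp id MonoList.neg
      have key : ∀ s, T.Adj s w → X s < X w → ∃ m, T.Adj m w ∧ X m < X w ∧ s ≠ m := by
        intro s _ _
        by_cases hsa : s = a
        · exact ⟨n, hn1, hn2, by rw [hsa]; exact hna.symm⟩
        · exact ⟨a, haadj, haw, hsa⟩
      have hsplit : ∀ u, Asc X T u w → Asc₂ X Y T u w ∨ Asc₂ X (fun x => -Y x) T u w := by
        intro u hu
        by_cases huw : u = w
        · subst huw; exact .inl .refl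
        obtain ⟨s, h1, h2, h3⟩ := hlast u hu huw
        obtain ⟨m, h4, h5, h6⟩ := key s h2 h3
        rcases lt_or_gt_of_ne (fun h => h2.ne (hY h) : Y s ≠ Y w) with h | h
        · exact .inl (asc₂_of_turn hT H h2 h3 h4 h5 h6 h h1)
        · exact .inr (asc₂_of_turn hT H' h2 h3 h4 h5 h6 (by simpa using h) h1)
      obtain ⟨E, hE, hE'⟩ := exists_leg hsplit
        (fun v s n h1 h2 h3 h4 => adj_unique hT H h1 h2 h3 h4)
        (fun v s n h1 h2 h3 h4 h5 h6 =>
          adj_unique hT H' h1 h2 h3 h4 (by simpa using h5) (by simpa using h6))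
        (a :: l) {w} w w rfl hl1.2 (by simpa using hl1.1)
        (by
          intro u
          rw [hmem u, Set.mem_singleton_iff]
          by_cases huw : u = w
          · subst huw; simp [Asc, Relation.ReflTransGen.refl]
          · simp [huw])
        (by rintro u rfl _ h; exact absurd rfl h) (by rintro u rfl _ h; exact absurd rfl h)
        le_rfl le_rfl
      exact ⟨E, .leg hE, hE'⟩
    · have hn' : ∀ n, T.Adj n w → X n < X w → n = a := fun n h1 h2 => by
        by_contra h
        exact hn ⟨n, h, h1, h2⟩
      obtain ⟨E, hE, hE'⟩ := ih a hl1.2 (by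
        intro u
        constructor
        · intro hu
          obtain ⟨s, h1, h2, h3⟩ := hlast u ((hmem u).1 (by simp [hu])).1
            ((hmem u).1 (by simp [hu])).2
          rw [hn' s h2 h3] at h1
          refine ⟨h1, ?_⟩
          rintro rfl
          exact lt_irrefl _ (hl2.1 u hu)
        · rintro ⟨h1, h2⟩
          have : u ∈ a :: l := (hmem u).2 ⟨h1.tail ⟨haadj, haw⟩, by
            rintro rfl
            exact absurd h1.le (not_le.2 haw)⟩
          exact (List.mem_cons.1 this).resolve_left h2)
      refine ⟨_, .ext hE, fun e he => ?_⟩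
      rw [List.mem_append, List.mem_singleton] at he
      rcases he with he | rfl
      · exact hE' e he
      · exact haadj

/-- Slide `w` along the path of the right half up to the apex of its legs, handing each path edge
over to the left half. -/
theorem exists_cand_of_halves {l r : List V} {w : V} {E F : List (V × V)} (hE : Half Y (w :: l) E)
    (hF : Half Y (w :: r) F) (hET : ∀ e ∈ E, T.Adj e.1 e.2) (hFT : ∀ e ∈ F, T.Adj e.1 e.2) :
    ∃ E', Cand Y (l.reverse ++ w :: r) E' ∧ ∀ e ∈ E', T.Adj e.1 e.2 := by
  generalize hm : w :: r = m at hF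
  induction hF generalizing w l r E with
  | @leg c r' F h =>
    obtain ⟨rfl, rfl⟩ := List.cons_eq_cons.1 hm
    refine ⟨E ++ F, ⟨l, w, r, E, F, rfl, hE, h, rfl⟩, fun e he => ?_⟩
    rcases List.mem_append.1 he with he | he
    · exact hET e he
    · exact hFT e he
  | @ext a c r' F h ih =>
    obtain ⟨rfl, rfl⟩ := List.cons_eq_cons.1 hm
    simp only [List.mem_append, List.mem_singleton] at hFT
    have hadj := hFT _ (.inr rfl)
    obtain ⟨E', h1, h2⟩ := ih (hE.ext (c := a)) (fun e he => by
      rw [List.mem_append, List.mem_singleton] at he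
      rcases he with he | rfl
      · exact hET e he
      · exact hadj.symm) (fun e he => hFT e (.inl he)) rfl
    exact ⟨E', by simpa using h1, h2⟩

theorem exists_cand_of_isCenter (hT : T.IsTree)
    (H : ∀ l, TPath T l → MonoList X l ∨ MonoList Y l) (hY : Function.Injective Y) {w : V}
    (hw : IsCenter X T w) {l : List V} (hl : l.Pairwise (fun u v => X u < X v))
    (hmem : ∀ u, u ∈ l) : ∃ E, Cand Y l E ∧ ∀ e ∈ E, T.Adj e.1 e.2 := by
  obtain ⟨s, r, rfl⟩ := List.append_of_mem (hmem w)
  have hl1 := List.pairwise_append.1 hl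
  have hl2 := List.pairwise_cons.1 hl1.2.1
  have hsw : ∀ u ∈ s, X u < X w := fun u hu => hl1.2.2 u hu w (by simp)
  have hmem' : ∀ u, u ∈ s ∨ u = w ∨ u ∈ r := fun u => by simpa using hmem u
  obtain ⟨E, hE, hE'⟩ := exists_half hT.isAcyclic H hY s.reverse w
    (by
      rw [List.pairwise_cons, List.pairwise_reverse]
      exact ⟨fun u hu => hsw u (by simpa using hu), hl1.1⟩)
    (by
      intro u
      rw [List.mem_reverse]
      constructor
      · intro hu
        refine ⟨(hw.comp hT u).resolve_left fun h => ?_, ?_⟩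
        · exact absurd h.le (not_le.2 (hsw u hu))
        · rintro rfl; exact lt_irrefl _ (hsw u hu)
      · rintro ⟨h1, h2⟩
        rcases hmem' u with h | h | h
        · exact h
        · exact absurd h h2
        · exact absurd h1.le (not_le.2 (hl2.1 u h)))
  have H' : ∀ l, TPath T l → MonoList (fun x => -X x) l ∨ MonoList Y l := fun l hl =>
    (H l hl).imp MonoList.neg id
  obtain ⟨F, hF, hF'⟩ := exists_half hT.isAcyclic H' hY r w (by simpa using hl1.2.1)
    (by
      intro u
      constructor
      · intro hu
        have h1 : Asc X T w u := (hw.comp hT u).resolve_right fun h =>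
          absurd h.le (not_le.2 (hl2.1 u hu))
        refine ⟨Asc.neg (by simpa using h1), ?_⟩
        rintro rfl; exact lt_irrefl _ (hl2.1 u hu)
      · rintro ⟨h1, h2⟩
        rcases hmem' u with h | h | h
        · exact absurd h1.neg.le (not_le.2 (hsw u h))
        · exact absurd h h2
        · exact h)
  obtain ⟨E', h1, h2⟩ := exists_cand_of_halves hE hF hE' hF'
  exact ⟨E', by simpa using h1, h2⟩

end center

/-! ### Optimality of a shortest candidate -/

theorem IsMonotoneSpanningTree.exists_cand [Finite V] {p : V → Plane} {d d' : Plane}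
    {T : SimpleGraph V} (h : IsMonotoneSpanningTree p {d, d'} T)
    (hd : Function.Injective fun v => (inner ℝ d (p v) : ℝ))
    (hd' : Function.Injective fun v => (inner ℝ d' (p v) : ℝ)) {l l' : List V}
    (hl : l.Pairwise (fun u v => (inner ℝ d (p u) : ℝ) < inner ℝ d (p v)))
    (hl' : l'.Pairwise (fun u v => (inner ℝ d' (p u) : ℝ) < inner ℝ d' (p v)))
    (hmem : ∀ u, u ∈ l) (hmem' : ∀ u, u ∈ l') :
    ∃ E, (Cand (fun v => inner ℝ d' (p v)) l E ∨ Cand (fun v => inner ℝ d (p v)) l' E) ∧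
      ∀ e ∈ E, T.Adj e.1 e.2 := by
  have hT := h.1
  have := hT.connected.nonempty
  have H : ∀ l, TPath T l →
      MonoList (fun v => inner ℝ d (p v)) l ∨ MonoList (fun v => inner ℝ d' (p v)) l := by
    intro l hl
    by_cases hne : l = []
    · subst hne; exact .inl (.inl .nil)
    obtain ⟨e, he, hm⟩ := h.2 _ _ (SimpleGraph.Walk.ofSupport l hne hl.1) (by
      rw [SimpleGraph.Walk.isPath_def, SimpleGraph.Walk.support_ofSupport]; exact hl.2)
    rw [SimpleGraph.Walk.support_ofSupport] at hm
    rcases he with rfl | rfl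
    · exact .inl hm
    · exact .inr hm
  rcases exists_isCenter hT hd H with ⟨c, hc⟩ | ⟨c, hc⟩
  · obtain ⟨E, h1, h2⟩ := exists_cand_of_isCenter hT H hd' hc hl hmem
    exact ⟨E, .inl h1, h2⟩
  · obtain ⟨E, h1, h2⟩ := exists_cand_of_isCenter hT (fun l hl => (H l hl).symm) hd hc hl' hmem'
    exact ⟨E, .inr h1, h2⟩

/-- A shortest one among the candidate trees for both directions is a minimum monotone spanning
tree. -/
theorem isMinimumMonotoneSpanningTree_of_cand [Finite V] [Nonempty V] {p : V → Plane}
    {d d' : Plane}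
    (hd : Function.Injective fun v => (inner ℝ d (p v) : ℝ))
    (hd' : Function.Injective fun v => (inner ℝ d' (p v) : ℝ)) {l l' : List V}
    (hl : l.Pairwise (fun u v => (inner ℝ d (p u) : ℝ) < inner ℝ d (p v)))
    (hl' : l'.Pairwise (fun u v => (inner ℝ d' (p u) : ℝ) < inner ℝ d' (p v)))
    (hmem : ∀ u, u ∈ l) (hmem' : ∀ u, u ∈ l') {E : List (V × V)}
    (hE : Cand (fun v => inner ℝ d' (p v)) l E ∨ Cand (fun v => inner ℝ d (p v)) l' E)
    (hmin : ∀ F, (Cand (fun v => inner ℝ d' (p v)) l F ∨ Cand (fun v => inner ℝ d (p v)) l' F) →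
      listLength p E ≤ listLength p F) :
    IsMinimumMonotoneSpanningTree p {d, d'} (listGraph E) := by
  have hn : ∀ {f : V → ℝ} {m : List V}, m.Pairwise (fun u v => f u < f v) → m.Nodup := fun h =>
    h.imp fun h => by rintro rfl; exact lt_irrefl _ h
  have hc : ∀ {m : List V}, m.Nodup → (∀ u, u ∈ m) → m.length = Nat.card V := by
    classical
    intro m h1 h2
    have := Fintype.ofFinite V
    rw [← List.toFinset_card_of_nodup h1, Nat.card_eq_fintype_card, ← Finset.card_univ]
    congr 1
    ext u
    simp [h2]
  have hpos : 0 < Nat.card V := Nat.card_pos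
  have key : ∀ F, (Cand (fun v => inner ℝ d' (p v)) l F ∨ Cand (fun v => inner ℝ d (p v)) l' F) →
      (∀ e ∈ F, e.1 ≠ e.2) ∧ F.length + 1 = Nat.card V ∧
        IsMonotoneSpanningTree p {d, d'} (listGraph F) := by
    rintro F (hF | hF)
    · have h1 := hF.ne (hn hl)
      have h2 : F.length + 1 = Nat.card V := by rw [hF.length, hc (hn hl) hmem]; lia
      exact ⟨h1, h2, isMonotoneSpanningTree_of_comp h1 h2 fun u v =>
        hF.comp (listGraph_adj h1) hl u (hmem u) v (hmem v)⟩
    · have h1 := hF.ne (hn hl')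
      have h2 : F.length + 1 = Nat.card V := by rw [hF.length, hc (hn hl') hmem']; lia
      exact ⟨h1, h2, isMonotoneSpanningTree_of_comp h1 h2 fun u v =>
        (hF.comp (listGraph_adj h1) hl' u (hmem' u) v (hmem' v)).symm⟩
  refine ⟨(key E hE).2.2, fun T hT => ?_⟩
  obtain ⟨F, hF, hFT⟩ := hT.exists_cand hd hd' hl hl' hmem hmem'
  obtain ⟨k1, k2, k3⟩ := key F hF
  -- The candidate is a connected spanning subgraph of `T`, and a tree is minimal among connected
  -- graphs.
  have : listGraph F = T := by
    have h1 := SimpleGraph.isTree_iff_minimal_connected.1 hT.1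
    exact h1.eq_of_le k3.1.connected (listGraph_le hFT)
  rw [← this, graphLength_listGraph k1 k2 k3.1,
    graphLength_listGraph (key E hE).1 (key E hE).2.1 (key E hE).2.2.1]
  exact hmin F hF

end MonotoneTree

/-! ### Reasoning about programs with time bounds -/

namespace RealRAM

/-- Started with memory `σ`, the program halts after at most `c` steps with a memory satisfying
`Q`. -/
def Term (P : Program) (σ : Store) (c : ℕ) (Q : Store → Prop) : Prop :=
  ∃ τ t, Runs P σ τ t ∧ t ≤ c ∧ Q τ

theorem Term.mono {P : Program} {σ : Store} {c c' : ℕ} {Q Q' : Store → Prop} (h : Term P σ c Q)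
    (hc : c ≤ c') (hQ : ∀ τ, Q τ → Q' τ) : Term P σ c' Q' := by
  obtain ⟨τ, t, h1, h2, h3⟩ := h
  exact ⟨τ, t, h1, h2.trans hc, hQ τ h3⟩

theorem Term.seq {P P' : Program} {σ : Store} {c c' : ℕ} {Q Q' : Store → Prop} (h : Term P σ c Q)
    (h' : ∀ τ, Q τ → Term P' τ c' Q') : Term (.seq P P') σ (c + c') Q' := by
  obtain ⟨τ, t, h1, h2, h3⟩ := h
  obtain ⟨τ', t', h1', h2', h3'⟩ := h' τ h3
  exact ⟨τ', t + t', .seq h1 h1', add_le_add h2 h2', h3'⟩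

theorem Term.ite {b : Test} {P P' : Program} {σ : Store} {c : ℕ} {Q : Store → Prop}
    (h : b.Holds σ → Term P σ c Q) (h' : ¬ b.Holds σ → Term P' σ c Q) :
    Term (.ite b P P') σ (b.cost + 1 + c) Q := by
  by_cases hb : b.Holds σ
  · obtain ⟨τ, t, h1, h2, h3⟩ := h hb
    exact ⟨τ, _, .iteTrue hb h1, by lia, h3⟩
  · obtain ⟨τ, t, h1, h2, h3⟩ := h' hb
    exact ⟨τ, _, .iteFalse hb h1, by lia, h3⟩

/-- The index of the invariant decreases strictly in each round, so it bounds the number of rounds.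
-/
theorem Term.while {b : Test} {P : Program} {c : ℕ} {Inv : ℕ → Store → Prop}
    (hstep : ∀ m σ, Inv m σ → b.Holds σ → Term P σ c (fun τ => ∃ m' < m, Inv m' τ))
    {m : ℕ} {σ : Store} (h : Inv m σ) :
    Term (.while b P) σ ((b.cost + 1 + c) * m + (b.cost + 1))
      (fun τ => (∃ m', Inv m' τ) ∧ ¬ b.Holds τ) := by
  induction m using Nat.strong_induction_on generalizing σ with
  | _ m ih =>
    by_cases hb : b.Holds σ
    · obtain ⟨ρ, s, h1, h2, m', hm, h3⟩ := hstep m σ h hb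
      obtain ⟨τ, t, h4, h5, h6⟩ := ih m' hm h3
      refine ⟨τ, _, .whileTrue hb h1 h4, ?_, h6⟩
      have : (b.cost + 1 + c) * (m' + 1) ≤ (b.cost + 1 + c) * m := Nat.mul_le_mul_left _ hm
      rw [mul_add, mul_one] at this
      lia
    · exact ⟨σ, _, .whileFalse hb, by lia, ⟨m, h⟩, hb⟩

/-- The program contains no loop. -/
def Program.loopFree : Program → Bool
  | .skip => true
  | .setNat _ _ _ => true
  | .setReal _ _ _ => true
  | .seq P Q => P.loopFree && Q.loopFree
  | .ite _ P Q => P.loopFree && Q.loopFree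
  | .while _ _ => false

/-- The final memory of a program without loops. -/
noncomputable def Program.exec (σ : Store) : Program → Store
  | .skip => σ
  | .setNat a i e => σ.writeNat a (i.eval σ) (e.eval σ)
  | .setReal a i e => σ.writeReal a (i.eval σ) (e.eval σ)
  | .seq P Q => Q.exec (P.exec σ)
  | .ite b P Q => open Classical in if b.Holds σ then P.exec σ else Q.exec σ
  | .while _ _ => σ

/-- A bound for the running time of a program without loops. -/
def Program.bound : Program → ℕ
  | .skip => 1
  | .setNat _ i e => i.cost + e.cost + 1
  | .setReal _ i e => i.cost + e.cost + 1
  | .seq P Q => P.bound + Q.bound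
  | .ite b P Q => b.cost + 1 + (P.bound + Q.bound)
  | .while _ _ => 0

/-- Reduces loop-free code to an explicit final memory, which can be computed by simplification. -/
theorem term_exec {P : Program} (hP : P.loopFree = true) {σ : Store} {c : ℕ} {Q : Store → Prop}
    (hc : P.bound ≤ c) (h : Q (P.exec σ)) : Term P σ c Q := by
  refine Term.mono (c := P.bound) (Q := fun τ => τ = P.exec σ) ?_ hc (by rintro _ rfl; exact h)
  clear h hc
  induction P generalizing σ with
  | skip => exact ⟨_, _, .skip σ, le_rfl, rfl⟩
  | setNat a i e => exact ⟨_, _, .setNat σ a i e, le_rfl, rfl⟩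
  | setReal a i e => exact ⟨_, _, .setReal σ a i e, le_rfl, rfl⟩
  | seq P Q ihP ihQ =>
    simp only [Program.loopFree, Bool.and_eq_true] at hP
    exact (ihP hP.1).seq (by rintro _ rfl; exact ihQ hP.2)
  | ite b P Q ihP ihQ =>
    simp only [Program.loopFree, Bool.and_eq_true] at hP
    refine Term.ite (fun hb => ?_) (fun hb => ?_)
    · exact (ihP hP.1).mono (by lia) (by rintro _ rfl; simp [Program.exec, hb])
    · exact (ihQ hP.2).mono (by lia) (by rintro _ rfl; simp [Program.exec, hb])
  | _ => simp [Program.loopFree] at hP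

theorem writeNat_nat (σ : Store) (a i x b : ℕ) :
    (σ.writeNat a i x).nat b = if b = a then Function.update (σ.nat a) i x else σ.nat b := by
  simp only [Store.writeNat, Function.update_apply]

theorem writeNat_real (σ : Store) (a i x : ℕ) : (σ.writeNat a i x).real = σ.real := rfl

theorem writeReal_real (σ : Store) (a i : ℕ) (x : ℝ) (b : ℕ) :
    (σ.writeReal a i x).real b = if b = a then Function.update (σ.real a) i x else σ.real b := by
  simp only [Store.writeReal, Function.update_apply]

theorem writeReal_nat (σ : Store) (a i : ℕ) (x : ℝ) : (σ.writeReal a i x).nat = σ.nat := rfl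

/-- The index variable with name `a`: the first cell of the index array `a`. -/
abbrev var (a : ℕ) : NatExp := .get a (.lit 0)

/-- The loop over the values of the variable `v` below the value of the variable `b`. -/
def forLoop (v b : ℕ) (P : Program) : Program :=
  .seq (.setNat v (.lit 0) (.lit 0))
    (.while (.natLt (var v) (var b)) (.seq P (.setNat v (.lit 0) (.succ (var v)))))

/-- The body must leave the counter alone; the invariant is required only after the increment. Each
round costs `c` for the body, 6 for the test and 5 for the increment, which gives `c + 11`. -/
theorem term_forLoop {v b : ℕ} {P : Program} {c N : ℕ} {Inv : ℕ → Store → Prop}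
    (hInv : ∀ k σ, Inv k σ → σ.nat v 0 = k ∧ σ.nat b 0 = N)
    (hstep : ∀ k < N, ∀ σ, Inv k σ →
      Term P σ c (fun τ => τ.nat v 0 = k ∧ Inv (k + 1) (τ.writeNat v 0 (k + 1))))
    {σ : Store} (h : Inv 0 (σ.writeNat v 0 0)) :
    Term (forLoop v b P) σ ((c + 11) * (N + 1)) (Inv N) := by
  have h1 : Term (.setNat v (.lit 0) (.lit 0)) σ 3 (fun τ => ∃ k ≤ N, N - k = N ∧ Inv k τ) :=
    term_exec rfl le_rfl ⟨0, by simp, by simp, h⟩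
  refine (h1.seq (c' := (c + 11) * N + 6) (Q' := Inv N) ?_).mono (by lia) (fun _ h => h)
  rintro τ ⟨k, hk, hkN, hτ⟩
  refine (Term.while (m := N) (Inv := fun m σ => ∃ k ≤ N, N - k = m ∧ Inv k σ) (c := c + 5) ?_
    ⟨k, hk, hkN, hτ⟩).mono ?_ ?_
  · rintro m σ ⟨k, hk, rfl, hσ⟩ hb
    simp only [Test.Holds, NatExp.eval, hInv k σ hσ] at hb
    refine (hstep k hb σ hσ).seq (c' := 5) ?_
    rintro τ ⟨h1, h2⟩
    refine term_exec rfl le_rfl ⟨N - (k + 1), by lia, k + 1, hb, rfl, ?_⟩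
    simpa only [Program.exec, NatExp.eval, h1] using h2
  · simp only [Test.cost, NatExp.cost]
    lia
  · rintro τ ⟨⟨m, k, hk, rfl, hτ⟩, hb⟩
    simp only [Test.Holds, NatExp.eval, hInv k τ hτ] at hb
    have : k = N := by lia
    rwa [this] at hτ

/-- The memory changes at most in the index arrays in `M` and the real arrays in `R`. -/
def Frame (M R : List ℕ) (σ τ : Store) : Prop :=
  (∀ a, a ∉ M → τ.nat a = σ.nat a) ∧ ∀ a, a ∉ R → τ.real a = σ.real a

theorem Frame.refl (M R : List ℕ) (σ : Store) : Frame M R σ σ := ⟨fun _ _ => rfl, fun _ _ => rfl⟩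

theorem Frame.trans {M R : List ℕ} {σ τ ρ : Store} (h : Frame M R σ τ) (h' : Frame M R τ ρ) :
    Frame M R σ ρ :=
  ⟨fun a ha => (h'.1 a ha).trans (h.1 a ha), fun a ha => (h'.2 a ha).trans (h.2 a ha)⟩

theorem Frame.mono {M R M' R' : List ℕ} {σ τ : Store} (h : Frame M R σ τ) (hM : M ⊆ M')
    (hR : R ⊆ R') : Frame M' R' σ τ :=
  ⟨fun a ha => h.1 a fun h => ha (hM h), fun a ha => h.2 a fun h => ha (hR h)⟩

theorem Frame.writeNat {M R : List ℕ} {σ τ : Store} (h : Frame M R σ τ) {a : ℕ} (ha : a ∈ M)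
    (i x : ℕ) : Frame M R σ (τ.writeNat a i x) := by
  refine ⟨fun b hb => ?_, h.2⟩
  rw [writeNat_nat, if_neg (by rintro rfl; exact hb ha), h.1 b hb]

theorem Frame.writeReal {M R : List ℕ} {σ τ : Store} (h : Frame M R σ τ) {a : ℕ} (ha : a ∈ R)
    (i : ℕ) (x : ℝ) : Frame M R σ (τ.writeReal a i x) := by
  refine ⟨h.1, fun b hb => ?_⟩
  rw [writeReal_real, if_neg (by rintro rfl; exact hb ha), h.2 b hb]

/-- The program writes only to index arrays in `M` and real arrays in `R`. -/
def Program.writesOnly (M R : List ℕ) : Program → Bool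
  | .skip => true
  | .setNat a _ _ => M.contains a
  | .setReal a _ _ => R.contains a
  | .seq P Q => P.writesOnly M R && Q.writesOnly M R
  | .ite _ P Q => P.writesOnly M R && Q.writesOnly M R
  | .while _ P => P.writesOnly M R

theorem Runs.frame {P : Program} {σ τ : Store} {t : ℕ} (h : Runs P σ τ t) {M R : List ℕ}
    (hP : P.writesOnly M R = true) : Frame M R σ τ := by
  induction h with
  | skip => exact .refl _ _ _
  | setNat σ a i e => exact (Frame.refl _ _ _).writeNat (by simpa [Program.writesOnly] using hP) _ _
  | setReal σ a i e => exact (Frame.refl _ _ _).writeReal (by simpa [Program.writesOnly] using hP) _ _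
  | seq _ _ ih ih' =>
    simp only [Program.writesOnly, Bool.and_eq_true] at hP
    exact (ih hP.1).trans (ih' hP.2)
  | iteTrue _ _ ih =>
    simp only [Program.writesOnly, Bool.and_eq_true] at hP
    exact ih hP.1
  | iteFalse _ _ ih =>
    simp only [Program.writesOnly, Bool.and_eq_true] at hP
    exact ih hP.2
  | whileFalse => exact .refl _ _ _
  | whileTrue _ _ _ ih ih' => exact (ih hP).trans (ih' hP)

/-- Preservation of untouched arrays is a syntactic condition, which holds by `rfl` for concrete
programs. -/
theorem Term.frame {P : Program} {σ : Store} {c : ℕ} {Q : Store → Prop} (h : Term P σ c Q)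
    (M R : List ℕ) (hP : P.writesOnly M R = true) :
    Term P σ c (fun τ => Q τ ∧ Frame M R σ τ) := by
  obtain ⟨τ, t, h1, h2, h3⟩ := h
  exact ⟨τ, t, h1, h2, h3, h1.frame hP⟩

end RealRAM

/-! ### Points, lists and edge lists in memory -/

namespace MonotoneTree

open RealRAM

variable {n : ℕ}

/-- The coordinates of the points `p` are in place. -/
structure Coord (p : Fin n → Plane) (σ : Store) : Prop where
  card : σ.nat 0 0 = n
  fst : ∀ u : Fin n, σ.real 0 u = p u 0
  snd : ∀ u : Fin n, σ.real 1 u = p u 1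

theorem Coord.frame {p : Fin n → Plane} {M R : List ℕ} {σ τ : Store} (h : Coord p σ)
    (hf : Frame M R σ τ) (hM : 0 ∉ M) (hR : 0 ∉ R ∧ 1 ∉ R) : Coord p τ := by
  obtain ⟨h1, h2, h3⟩ := h
  rw [← hf.1 0 hM] at h1
  rw [← hf.2 0 hR.1] at h2
  rw [← hf.2 1 hR.2] at h3
  exact ⟨h1, h2, h3⟩

/-- The index array `s` holds the list `l` of points. -/
def HoldsList (s : ℕ) (l : List (Fin n)) (σ : Store) : Prop :=
  ∀ i (h : i < l.length), σ.nat s i = l[i]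

theorem HoldsList.frame {s : ℕ} {l : List (Fin n)} {M R : List ℕ} {σ τ : Store}
    (h : HoldsList s l σ) (hf : Frame M R σ τ) (hs : s ∉ M) : HoldsList s l τ := by
  rwa [HoldsList, hf.1 s hs]

/-- The real array `a` holds the function `Y` on the points. -/
def HoldsFun (a : ℕ) (Y : Fin n → ℝ) (σ : Store) : Prop := ∀ u : Fin n, σ.real a u = Y u

theorem HoldsFun.frame {a : ℕ} {Y : Fin n → ℝ} {M R : List ℕ} {σ τ : Store}
    (h : HoldsFun a Y σ) (hf : Frame M R σ τ) (ha : a ∉ R) : HoldsFun a Y τ := by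
  rwa [HoldsFun, hf.2 a ha]

/-- The names of arrays that hold an edge list, its number of edges and its length. -/
structure Reg where
  fst : ℕ
  snd : ℕ
  card : ℕ
  cost : ℕ

/-- The register holds the edge list `E`. -/
def Reg.Holds (r : Reg) (p : Fin n → Plane) (E : List (Fin n × Fin n)) (σ : Store) : Prop :=
  σ.nat r.card 0 = E.length ∧ σ.real r.cost 0 = listLength p E ∧
    ∀ i (h : i < E.length), σ.nat r.fst i = E[i].1 ∧ σ.nat r.snd i = E[i].2

/-- The register consists of none of the given arrays. -/
def Reg.Free (r : Reg) (M R : List ℕ) : Prop :=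
  r.fst ∉ M ∧ r.snd ∉ M ∧ r.card ∉ M ∧ r.cost ∉ R

theorem Reg.Holds.frame {r : Reg} {p : Fin n → Plane} {E : List (Fin n × Fin n)} {M R : List ℕ}
    {σ τ : Store} (h : r.Holds p E σ) (hf : Frame M R σ τ) (hr : r.Free M R) : r.Holds p E τ := by
  rwa [Reg.Holds, hf.1 _ hr.1, hf.1 _ hr.2.1, hf.1 _ hr.2.2.1, hf.2 _ hr.2.2.2]

/-- Append the edge with the endpoints `u` and `v` to the edge list in the register. -/
def appendEdge (r : Reg) (u v : NatExp) : Program :=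
  .seq (.setNat r.fst (var r.card) u) <| .seq (.setNat r.snd (var r.card) v) <|
  .seq (.setReal r.cost (.lit 0) (.add (.get r.cost (.lit 0)) (.sqrt (.add
    (.mul (.sub (.get 0 u) (.get 0 v)) (.sub (.get 0 u) (.get 0 v)))
    (.mul (.sub (.get 1 u) (.get 1 v)) (.sub (.get 1 u) (.get 1 v))))))) <|
  .setNat r.card (.lit 0) (.succ (var r.card))

theorem dist_eq_sqrt (x y : Plane) :
    dist x y = Real.sqrt ((x 0 - y 0) * (x 0 - y 0) + (x 1 - y 1) * (x 1 - y 1)) := by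
  simp [EuclideanSpace.dist_eq, Fin.sum_univ_two, Real.dist_eq, pow_two]

/-- The expressions `u` and `v` are evaluated repeatedly while the register is being written; `hu`
and `hv` guarantee that they keep their values. -/
theorem term_appendEdge {r : Reg} {p : Fin n → Plane} {E : List (Fin n × Fin n)} {u v : NatExp}
    {σ : Store} {a b : Fin n} (hr : [r.fst, r.snd, r.card].Nodup)
    (hp : Coord p σ) (hE : r.Holds p E σ)
    (hu : ∀ τ, Frame [r.fst, r.snd, r.card] [r.cost] σ τ → u.eval τ = a)
    (hv : ∀ τ, Frame [r.fst, r.snd, r.card] [r.cost] σ τ → v.eval τ = b) :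
    Term (appendEdge r u v) σ (5 * u.cost + 5 * v.cost + 40) (r.Holds p (E ++ [(a, b)])) := by
  have hr2 := List.nodup_reverse.2 hr
  simp only [List.reverse_cons, List.reverse_nil, List.nil_append, List.cons_append,
    List.nodup_cons, List.mem_cons, List.not_mem_nil, or_false, not_or, not_false_eq_true,
    List.nodup_nil, and_true] at hr hr2
  refine term_exec rfl ?_ ?_
  · simp [appendEdge, Program.bound, NatExp.cost, RealExp.cost]
    lia
  have f0 := Frame.refl [r.fst, r.snd, r.card] [r.cost] σ
  have f1 := f0.writeNat (a := r.fst) (by simp) (σ.nat r.card 0) a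
  have f2 := f1.writeNat (a := r.snd) (by simp) (σ.nat r.card 0) b
  simp only [appendEdge, Program.exec, NatExp.eval, RealExp.eval, hu _ f0, hv _ f1,
    writeNat_nat, hr2, if_false, hu _ f2, hv _ f2, writeNat_real, hp.fst, hp.snd,
    ← dist_eq_sqrt]
  obtain ⟨h1, h2, h3⟩ := hE
  simp only [Reg.Holds, writeNat_nat, writeReal_nat, writeNat_real, writeReal_real, hr, hr2, h1, h2,
    if_false, if_true, Function.update_self, List.length_append, List.length_singleton,
    listLength_append]
  refine ⟨trivial, by simp [listLength], fun i hi => ?_⟩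
  rcases Nat.lt_succ_iff_lt_or_eq.1 hi with hi | rfl
  · rw [Function.update_of_ne hi.ne, Function.update_of_ne hi.ne, List.getElem_append_left hi]
    exact h3 i hi
  · simp

/-- Copy the edge list in the register `r` to the register `s`. -/
def copyReg (r s : Reg) : Program :=
  .seq (forLoop 19 r.card (.seq (.setNat s.fst (var 19) (.get r.fst (var 19)))
    (.setNat s.snd (var 19) (.get r.snd (var 19))))) <|
  .seq (.setNat s.card (.lit 0) (var r.card)) (.setReal s.cost (.lit 0) (.get r.cost (.lit 0)))

theorem term_copyReg {r s : Reg} {p : Fin n → Plane} {E : List (Fin n × Fin n)} {σ : Store}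
    (hd : [19, r.fst, r.snd, r.card, s.fst, s.snd, s.card].Nodup) (hE : r.Holds p E σ) :
    Term (copyReg r s) σ (40 * (E.length + 1)) (s.Holds p E) := by
  have hd2 := List.nodup_reverse.2 hd
  simp only [List.reverse_cons, List.reverse_nil, List.nil_append, List.cons_append,
    List.nodup_cons, List.mem_cons, List.not_mem_nil, or_false, not_or, not_false_eq_true,
    List.nodup_nil, and_true] at hd hd2
  let Inv : ℕ → Store → Prop := fun k σ => σ.nat 19 0 = k ∧ r.Holds p E σ ∧
    ∀ i < k, ∀ h : i < E.length, σ.nat s.fst i = E[i].1 ∧ σ.nat s.snd i = E[i].2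
  have h1 := term_forLoop (v := 19) (b := r.card) (N := E.length) (Inv := Inv) (c := 15)
    (P := .seq (.setNat s.fst (var 19) (.get r.fst (var 19)))
      (.setNat s.snd (var 19) (.get r.snd (var 19)))) (σ := σ)
    (fun k σ h => ⟨h.1, h.2.1.1⟩) ?_ ?_
  · refine (h1.seq (c' := 10) (Q' := s.Holds p E) ?_).mono (by lia) (fun _ h => h)
    rintro τ ⟨-, ⟨k1, k2, k3⟩, k4⟩
    refine term_exec rfl (by simp [Program.bound, NatExp.cost, RealExp.cost]) ?_
    simp only [Program.exec, NatExp.eval, RealExp.eval, Reg.Holds, writeNat_nat, writeReal_nat,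
      writeNat_real, writeReal_real, hd, if_false, if_true, Function.update_self, k1, k2]
    exact ⟨trivial, trivial, fun i hi => k4 i hi hi⟩
  · rintro k hk τ ⟨k0, ⟨k1, k2, k3⟩, k4⟩
    refine term_exec rfl (by simp [Program.bound, NatExp.cost]) ?_
    simp only [Inv, Program.exec, NatExp.eval, Reg.Holds, writeNat_nat, writeNat_real, hd, hd2,
      if_false, if_true, Function.update_self, k0, k1, k2]
    refine ⟨trivial, trivial, ⟨trivial, trivial, k3⟩, fun i hi h => ?_⟩
    rcases Nat.lt_succ_iff_lt_or_eq.1 hi with hi | rfl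
    · rw [Function.update_of_ne hi.ne, Function.update_of_ne hi.ne]
      exact k4 i hi h
    · rw [Function.update_self, Function.update_self]
      exact k3 i h
  · obtain ⟨k1, k2, k3⟩ := hE
    simp only [Inv, Reg.Holds, writeNat_nat, writeNat_real, hd2, if_false, if_true,
      Function.update_self, k1, k2]
    exact ⟨trivial, ⟨trivial, trivial, k3⟩, by simp⟩

/-- Replace the edge list in the register `s` by the one in `r`, if `s` is empty or longer. -/
def pickReg (r s : Reg) : Program :=
  .ite (.and (.natLt (.lit 0) (var s.card))
      (.not (.realLt (.get r.cost (.lit 0)) (.get s.cost (.lit 0)))))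
    .skip (copyReg r s)

/-- `D` is a shortest list in `S`, or `S` is empty and so is `D`. -/
def Best (p : Fin n → Plane) (S : Set (List (Fin n × Fin n))) (D : List (Fin n × Fin n)) : Prop :=
  (D ∈ S ∧ ∀ E ∈ S, listLength p D ≤ listLength p E) ∨ S = ∅ ∧ D = []

/-- Cardinality `0` in `s` serves as the mark for "nothing found yet". The common length `m` of all
lists makes this unambiguous for `m > 0` and bounds the time of copying. -/
theorem term_pickReg {r s : Reg} {p : Fin n → Plane} {D E : List (Fin n × Fin n)} {σ : Store}
    {S S' : Set (List (Fin n × Fin n))}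
    (hd : [19, r.fst, r.snd, r.card, s.fst, s.snd, s.card].Nodup) (hE : r.Holds p E σ)
    (hD : s.Holds p D σ) (hS : Best p S D) (hS' : E ∈ S' ∧ ∀ F ∈ S', listLength p E ≤ listLength p F)
    {m : ℕ} (hm : ∀ F ∈ S ∪ S', F.length = m) :
    Term (pickReg r s) σ (60 * (m + 1)) (fun τ => ∃ D', s.Holds p D' τ ∧ Best p (S ∪ S') D') := by
  have hEm := hm E (.inr hS'.1)
  refine (Term.ite (c := 40 * (m + 1)) (fun hb => ?_) (fun hb => ?_)).mono ?_ (fun _ h => h)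
  · simp only [Test.Holds, NatExp.eval, RealExp.eval, hE.2.1, hD.2.1, hD.1, not_lt] at hb
    refine term_exec rfl (by simp [Program.bound]; lia) ⟨D, hD, .inl ?_⟩
    rcases hS with ⟨h1, h2⟩ | ⟨-, rfl⟩
    · refine ⟨.inl h1, ?_⟩
      rintro F (hF | hF)
      · exact h2 F hF
      · exact hb.2.trans (hS'.2 F hF)
    · simp at hb
  · simp only [Test.Holds, NatExp.eval, RealExp.eval, hE.2.1, hD.2.1, hD.1, not_and, not_not] at hb
    rw [← hEm]
    refine (term_copyReg hd hE).mono le_rfl fun τ hτ => ⟨E, hτ, .inl ⟨.inr hS'.1, ?_⟩⟩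
    rintro F (hF | hF)
    · rcases hS with ⟨h1, h2⟩ | ⟨rfl, rfl⟩
      -- If `m = 0`, all lists in question are empty and overwriting does no harm.
      · rcases Nat.eq_zero_or_pos D.length with h3 | h3
        · rw [hm D (.inl h1)] at h3
          have hF' := hm F (.inl hF)
          rw [h3, List.length_eq_zero_iff] at hEm hF'
          rw [hEm, hF']
        · exact (hb h3).le.trans (h2 F hF)
      · exact hF.elim
    · exact hS'.2 F hF
  · simp only [Test.cost, NatExp.cost, RealExp.cost]
    lia

/-- The register for the output. -/
def regOut : Reg := ⟨1, 2, 3, 6⟩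

/-- The register for the left half of a tree. -/
def regHalf : Reg := ⟨4, 5, 6, 7⟩

/-- The register for a tree under construction. -/
def regTree : Reg := ⟨7, 8, 9, 8⟩

/-! ### Computing a pair of legs in linear time -/

/-- Extend the tree under construction by the legs on the points preceding position `c` in the
list in the index array `s`. -/
def legProgram (s c : ℕ) : Program :=
  .seq (.setNat 15 (.lit 0) (var c)) <| .seq (.setNat 16 (.lit 0) (.get s (var c))) <|
  .seq (.setNat 17 (.lit 0) (.get s (var c))) <| .seq (.setNat 18 (.lit 0) (.lit 1)) <|
  .while (.and (.natLt (.lit 0) (var 15)) (.natLt (.lit 0) (var 18))) <|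
    .seq (.seq (.setNat 15 (.lit 0) (.pred (var 15))) (.setNat 22 (.lit 0) (.get s (var 15)))) <|
    .ite (.realLt (.get 4 (var 22)) (.get 4 (var 16)))
      (.seq (appendEdge regTree (var 22) (var 16)) (.setNat 16 (.lit 0) (var 22))) <|
    .ite (.realLt (.get 4 (var 17)) (.get 4 (var 22)))
      (.seq (appendEdge regTree (var 22) (var 17)) (.setNat 17 (.lit 0) (var 22)))
      (.setNat 18 (.lit 0) (.lit 0))

/-- Variable 15 is the position down to which the list has been processed, 16 and 17 are the ends of
the legs, 18 is `1` until a point fails to be extreme, and 22 is the current point. The invariant: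
the whole result of `leg` is the edges `D` found so far followed by the result on the remaining
points. -/
theorem term_legProgram {p : Fin n → Plane} {Y : Fin n → ℝ} {E : List (Fin n × Fin n)}
    {l : List (Fin n)} {s c : ℕ} {σ : Store} {i : ℕ} (hi : i < l.length)
    (hs : s = 10 ∨ s = 11) (hc : c = 20 ∨ c = 21) (hci : σ.nat c 0 = i)
    (hp : Coord p σ) (hY : HoldsFun 4 Y σ) (hl : HoldsList s l σ) (hE : regTree.Holds p E σ) :
    Term (legProgram s c) σ (200 * (i + 1)) (fun τ =>
      (τ.nat 18 0 = 1 ∧ ∃ F, leg Y (l.take i).reverse l[i] l[i] = some F ∧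
        regTree.Holds p (E ++ F) τ) ∨
      (τ.nat 18 0 = 0 ∧ leg Y (l.take i).reverse l[i] l[i] = none)) := by
  let Inv : ℕ → Store → Prop := fun k τ =>
    k ≤ i ∧ τ.nat 15 0 = k ∧ Coord p τ ∧ HoldsFun 4 Y τ ∧ HoldsList s l τ ∧
    ∃ (a b : Fin n) (D : List (Fin n × Fin n)), τ.nat 16 0 = a ∧ τ.nat 17 0 = b ∧
      ((τ.nat 18 0 = 1 ∧ regTree.Holds p (E ++ D) τ ∧ leg Y (l.take i).reverse l[i] l[i] =
        (leg Y (l.take k).reverse a b).map (D ++ ·)) ∨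
      (τ.nat 18 0 = 0 ∧ leg Y (l.take i).reverse l[i] l[i] = none))
  let init : Program := .seq (.setNat 15 (.lit 0) (var c)) <|
    .seq (.setNat 16 (.lit 0) (.get s (var c))) <|
    .seq (.setNat 17 (.lit 0) (.get s (var c))) (.setNat 18 (.lit 0) (.lit 1))
  have hinit : Inv i (init.exec σ) := by
    have f : Frame [15, 16, 17, 18] [] σ (init.exec σ) :=
      ((((Frame.refl _ _ σ).writeNat (by simp) _ _).writeNat (by simp) _ _).writeNat
        (by simp) _ _).writeNat (by simp) _ _
    refine ⟨le_rfl, ?_, hp.frame f (by simp) (by simp), hY.frame f (by simp),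
      hl.frame f (by rcases hs with rfl | rfl <;> simp), l[i], l[i], [], ?_, ?_, .inl ⟨?_, ?_, ?_⟩⟩
    · rcases hc with rfl | rfl <;> simp [init, Program.exec, NatExp.eval, writeNat_nat, hci]
    · rcases hc with rfl | rfl <;> rcases hs with rfl | rfl <;>
        simp [init, Program.exec, NatExp.eval, writeNat_nat, hci, hl i hi]
    · rcases hc with rfl | rfl <;> rcases hs with rfl | rfl <;>
        simp [init, Program.exec, NatExp.eval, writeNat_nat, hci, hl i hi]
    · simp [init, Program.exec, NatExp.eval, writeNat_nat]
    · rw [List.append_nil]; exact hE.frame f (by simp [regTree, Reg.Free])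
    · simp
  have hstep : ∀ m τ, Inv m τ →
      (Test.and (.natLt (.lit 0) (var 15)) (.natLt (.lit 0) (var 18))).Holds τ →
      Term (.seq (.seq (.setNat 15 (.lit 0) (.pred (var 15)))
          (.setNat 22 (.lit 0) (.get s (var 15)))) <|
        .ite (.realLt (.get 4 (var 22)) (.get 4 (var 16)))
          (.seq (appendEdge regTree (var 22) (var 16)) (.setNat 16 (.lit 0) (var 22))) <|
        .ite (.realLt (.get 4 (var 17)) (.get 4 (var 22)))
          (.seq (appendEdge regTree (var 22) (var 17)) (.setNat 17 (.lit 0) (var 22)))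
          (.setNat 18 (.lit 0) (.lit 0))) τ 150 (fun τ => ∃ m' < m, Inv m' τ) := by
    rintro m τ ⟨hmi, h15, hp, hY, hl, a, b, D, h16, h17, hD⟩ hb
    simp only [Test.Holds, NatExp.eval, h15] at hb
    obtain ⟨k, rfl⟩ : ∃ k, m = k + 1 := ⟨m - 1, by lia⟩
    rcases hD with ⟨h18, hD, hleg⟩ | ⟨h18, -⟩
    swap
    · rw [h18] at hb; exact absurd hb.2 (lt_irrefl _)
    have hk : k < l.length := by lia
    have htake : (l.take (k + 1)).reverse = l[k] :: (l.take k).reverse := by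
      rw [List.take_add_one, List.getElem?_eq_getElem hk]; simp
    rw [htake, leg] at hleg
    have h1 : Term (.seq (.setNat 15 (.lit 0) (.pred (var 15)))
          (.setNat 22 (.lit 0) (.get s (var 15)))) τ 12 (fun ρ => Frame [15, 22] [] τ ρ ∧
        ρ.nat 15 0 = k ∧ ρ.nat 22 0 = l[k]) := by
      refine term_exec rfl (by simp [Program.bound, NatExp.cost]) ⟨?_, ?_, ?_⟩
      · exact ((Frame.refl _ _ _).writeNat (by simp) _ _).writeNat (by simp) _ _
      · simp [Program.exec, NatExp.eval, writeNat_nat, h15]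
      · rcases hs with rfl | rfl <;>
          simp [Program.exec, NatExp.eval, writeNat_nat, h15, hl k hk]
    refine (h1.seq (c' := 138) ?_).mono (by lia) (fun _ h => h)
    rintro ρ ⟨f, h15', h22⟩
    replace hp := hp.frame f (by simp) (by simp)
    replace hY := hY.frame f (by simp)
    replace hl := hl.frame f (by rcases hs with rfl | rfl <;> simp)
    replace hD := hD.frame f (by simp [regTree, Reg.Free])
    replace h16 : ρ.nat 16 0 = a := by rw [f.1 16 (by simp), h16]
    replace h17 : ρ.nat 17 0 = b := by rw [f.1 17 (by simp), h17]
    replace h18 : ρ.nat 18 0 = 1 := by rw [f.1 18 (by simp), h18]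
    refine (Term.ite (c := 120) (fun ht => ?_) (fun ht => ?_)).mono
      (by simp [Test.cost, RealExp.cost, NatExp.cost]) (fun _ h => h)
    · simp only [Test.Holds, RealExp.eval, NatExp.eval, h22, h16, hY _] at ht
      rw [if_pos ht] at hleg
      have h2 := (term_appendEdge (u := var 22) (v := var 16) (a := l[k]) (b := a)
        (by simp [regTree]) hp hD
        (by intro τ hτ; simp only [NatExp.eval]; rw [hτ.1 22 (by simp [regTree]), h22])
        (by intro τ hτ; simp only [NatExp.eval]; rw [hτ.1 16 (by simp [regTree]), h16])).frame
          [7, 8, 9] [8] rfl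
      refine (h2.seq (c' := 10) ?_).mono (by simp [NatExp.cost]) (fun _ h => h)
      rintro ρ' ⟨hD', f'⟩
      refine term_exec rfl (by simp [Program.bound, NatExp.cost]) ⟨k, by lia, ?_⟩
      have f'' := ((f'.mono (M' := [7, 8, 9, 16]) (R' := [8]) (by simp) (by simp)).writeNat
        (a := 16) (by simp) 0 (ρ'.nat 22 0))
      refine ⟨by lia, ?_, hp.frame f'' (by simp) (by simp), hY.frame f'' (by simp),
        hl.frame f'' (by rcases hs with rfl | rfl <;> simp), l[k], b, D ++ [(l[k], a)], ?_, ?_, .inl ⟨?_, ?_, ?_⟩⟩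
      · exact (congrFun (f''.1 15 (by simp)) 0).trans h15'
      · simp [Program.exec, NatExp.eval, writeNat_nat, f'.1 22 (by simp), h22]
      · exact (congrFun (f''.1 17 (by simp)) 0).trans h17
      · exact (congrFun (f''.1 18 (by simp)) 0).trans h18
      · rw [← List.append_assoc]
        exact hD'.frame ((Frame.refl [16] [] _).writeNat (by simp) _ _)
          (by simp [regTree, Reg.Free])
      · rw [hleg]
        simp [Function.comp_def]
    · simp only [Test.Holds, RealExp.eval, NatExp.eval, h22, h16, hY _] at ht
      rw [if_neg ht] at hleg
      refine (Term.ite (c := 100) (fun ht' => ?_) (fun ht' => ?_)).mono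
        (by simp [Test.cost, RealExp.cost, NatExp.cost]) (fun _ h => h)
      · simp only [Test.Holds, RealExp.eval, NatExp.eval, h22, h17, hY _] at ht'
        rw [if_pos ht'] at hleg
        have h2 := (term_appendEdge (u := var 22) (v := var 17) (a := l[k]) (b := b)
          (by simp [regTree]) hp hD
          (by intro τ hτ; simp only [NatExp.eval]; rw [hτ.1 22 (by simp [regTree]), h22])
          (by intro τ hτ; simp only [NatExp.eval]; rw [hτ.1 17 (by simp [regTree]), h17])).frame
            [7, 8, 9] [8] rfl
        refine (h2.seq (c' := 10) ?_).mono (by simp [NatExp.cost]) (fun _ h => h)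
        rintro ρ' ⟨hD', f'⟩
        refine term_exec rfl (by simp [Program.bound, NatExp.cost]) ⟨k, by lia, ?_⟩
        have f'' := ((f'.mono (M' := [7, 8, 9, 17]) (R' := [8]) (by simp) (by simp)).writeNat
          (a := 17) (by simp) 0 (ρ'.nat 22 0))
        refine ⟨by lia, ?_, hp.frame f'' (by simp) (by simp), hY.frame f'' (by simp),
          hl.frame f'' (by rcases hs with rfl | rfl <;> simp), a, l[k], D ++ [(l[k], b)], ?_, ?_, .inl ⟨?_, ?_, ?_⟩⟩
        · exact (congrFun (f''.1 15 (by simp)) 0).trans h15'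
        · exact (congrFun (f''.1 16 (by simp)) 0).trans h16
        · simp [Program.exec, NatExp.eval, writeNat_nat, f'.1 22 (by simp), h22]
        · exact (congrFun (f''.1 18 (by simp)) 0).trans h18
        · rw [← List.append_assoc]
          exact hD'.frame ((Frame.refl [17] [] _).writeNat (by simp) _ _)
            (by simp [regTree, Reg.Free])
        · rw [hleg]
          simp [Function.comp_def]
      · simp only [Test.Holds, RealExp.eval, NatExp.eval, h22, h17, hY _] at ht'
        rw [if_neg ht'] at hleg
        have f' := (Frame.refl [18] [] ρ).writeNat (a := 18) (by simp) 0 0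
        refine term_exec rfl (by simp [Program.bound, NatExp.cost]) ⟨k, by lia, by lia, ?_,
          hp.frame f' (by simp) (by simp), hY.frame f' (by simp),
          hl.frame f' (by rcases hs with rfl | rfl <;> simp), a, b, D, ?_, ?_, .inr ⟨?_, by simpa using hleg⟩⟩
        · exact (congrFun (f'.1 15 (by simp)) 0).trans h15'
        · exact (congrFun (f'.1 16 (by simp)) 0).trans h16
        · exact (congrFun (f'.1 17 (by simp)) 0).trans h17
        · simp [Program.exec, NatExp.eval, writeNat_nat]
  have hwhile := Term.while hstep hinit
  obtain ⟨τ, t, h1, h2, ⟨k, hmi, h15, -, -, -, a, b, D, -, -, hD⟩, hb⟩ := hwhile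
  refine ⟨τ, _, .seq (.setNat _ _ _ _) (.seq (.setNat _ _ _ _) (.seq (.setNat _ _ _ _)
    (.seq (.setNat _ _ _ _) h1))), ?_, ?_⟩
  · simp only [NatExp.cost, Test.cost] at h2 ⊢
    lia
  · simp only [Test.Holds, NatExp.eval, h15] at hb
    rcases hD with ⟨h18, hD, hleg⟩ | hD
    · rw [h18] at hb
      -- The flag is still `1`, so the loop has stopped because no points remain.
      have : k = 0 := by lia
      subst this
      exact .inl ⟨h18, D, by simpa [leg] using hleg, hD⟩
    · exact .inr hD

/-! ### Projections and sorting by ranks -/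

/-- The program `project i k` computes the projections `d ⬝ u`, `d' ⬝ u` and `-(d ⬝ u)` of all
points `u`, where `d` and `d'` start in the cells `i` and `k` of the array of directions. -/
def project (i k : ℕ) : Program :=
  forLoop 12 0 <|
  .seq (.setReal 3 (var 12) (.add (.mul (.get 2 (.lit i)) (.get 0 (var 12)))
    (.mul (.get 2 (.lit (i + 1))) (.get 1 (var 12))))) <|
  .seq (.setReal 4 (var 12) (.add (.mul (.get 2 (.lit k)) (.get 0 (var 12)))
    (.mul (.get 2 (.lit (k + 1))) (.get 1 (var 12)))))
  (.setReal 5 (var 12) (.sub (.lit 0) (.get 3 (var 12))))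

theorem term_project {p : Fin n → Plane} {d d' : Plane} {i k : ℕ} {σ : Store} (hp : Coord p σ)
    (hd : σ.real 2 i = d 0 ∧ σ.real 2 (i + 1) = d 1)
    (hd' : σ.real 2 k = d' 0 ∧ σ.real 2 (k + 1) = d' 1) :
    Term (project i k) σ (80 * (n + 1)) (fun τ => HoldsFun 3 (fun u => inner ℝ d (p u)) τ ∧
      HoldsFun 4 (fun u => inner ℝ d' (p u)) τ ∧ HoldsFun 5 (fun u => -inner ℝ d (p u)) τ) := by
  have hinner : ∀ x y : Plane, (inner ℝ x y : ℝ) = x 0 * y 0 + x 1 * y 1 := fun x y => by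
    simp [PiLp.inner_apply, Fin.sum_univ_two, mul_comm]
  let Inv : ℕ → Store → Prop := fun m τ => τ.nat 12 0 = m ∧ Coord p τ ∧
    τ.real 2 = σ.real 2 ∧ ∀ u : Fin n, (u : ℕ) < m → τ.real 3 u = inner ℝ d (p u) ∧
      τ.real 4 u = inner ℝ d' (p u) ∧ τ.real 5 u = -inner ℝ d (p u)
  refine (term_forLoop (Inv := Inv) (N := n) (c := 60) (fun m τ h => ⟨h.1, h.2.1.card⟩) ?_ ?_).mono
    (by lia) ?_
  · rintro m hm τ ⟨h12, hp', h2, h⟩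
    refine term_exec rfl (by simp [Program.bound, NatExp.cost, RealExp.cost]) ?_
    have e0 := hp'.fst ⟨m, hm⟩
    have e1 := hp'.snd ⟨m, hm⟩
    simp only at e0 e1
    refine ⟨by simpa [Program.exec, writeReal_nat, NatExp.eval] using h12, ?_, ?_, ?_, ?_⟩
    · simp [Program.exec, writeReal_nat, NatExp.eval, writeNat_nat]
    · refine hp'.frame (M := [12]) (R := [3, 4, 5]) ?_ (by simp) (by simp)
      exact ((((Frame.refl _ _ _).writeReal (by simp) _ _).writeReal (by simp) _ _).writeReal
        (by simp) _ _).writeNat (by simp) _ _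
    · simp [Program.exec, writeReal_nat, NatExp.eval, writeNat_real, writeReal_real, h2]
    · intro u hu
      simp only [Program.exec, RealExp.eval, writeReal_nat, NatExp.eval, writeNat_real,
        writeReal_real, h12, h2, hd, e0, e1]
      rcases Nat.lt_succ_iff_lt_or_eq.1 hu with hu | rfl
      · simpa [Function.update_of_ne hu.ne] using h u hu
      · simp [hinner, hd', e0, e1]
  · refine ⟨by simp [writeNat_nat], ?_, by simp [writeNat_real], by simp⟩
    exact hp.frame ((Frame.refl [12] [] _).writeNat (by simp) _ _) (by simp) (by simp)
  · rintro τ ⟨-, -, -, h⟩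
    exact ⟨fun u => (h u u.2).1, fun u => (h u u.2).2.1, fun u => (h u u.2).2.2⟩

/-- Sort the points by the real array `a`: write every point to the cell of the index array `s`
which is given by the number of the points preceding it. -/
def sortProgram (a s : ℕ) : Program :=
  forLoop 12 0 <|
  .seq (.seq (.setNat 14 (.lit 0) (.lit 0)) <|
    forLoop 13 0 <| .ite (.realLt (.get a (var 13)) (.get a (var 12)))
      (.setNat 14 (.lit 0) (.succ (var 14))) .skip) <|
  .setNat s (var 14) (var 12)

/-- The points with smaller value are exactly the entries before position `i`, so the rank computed
by counting is the position in the sorted list. -/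
theorem card_lt_getElem {f : Fin n → ℝ} {l : List (Fin n)} (hl : l.Pairwise (fun u v => f u < f v))
    (hmem : ∀ u, u ∈ l) {i : ℕ} (hi : i < l.length) :
    (Finset.univ.filter (fun v => f v < f l[i])).card = i := by
  have hnd : l.Nodup := hl.imp fun h => by rintro rfl; exact lt_irrefl _ h
  have : Finset.univ.filter (fun v => f v < f l[i]) = (l.take i).toFinset := by
    ext v
    simp only [Finset.mem_filter, Finset.mem_univ, true_and, List.mem_toFinset,
      List.mem_take_iff_getElem]
    rw [List.pairwise_iff_getElem] at hl
    constructor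
    · intro h
      obtain ⟨k, hk, rfl⟩ := List.getElem_of_mem (hmem v)
      refine ⟨k, lt_min ?_ hk, rfl⟩
      by_contra hik
      rcases (not_lt.1 hik).lt_or_eq with h1 | rfl
      · exact lt_asymm h (hl i k hi hk h1)
      · exact lt_irrefl _ h
    · rintro ⟨k, hk, rfl⟩
      exact hl k i _ hi (lt_min_iff.1 hk).1
  rw [this, List.toFinset_card_of_nodup (hnd.sublist (List.take_sublist _ _)), List.length_take]
  lia

theorem card_lt_succ {f : Fin n → ℝ} {x : ℝ} {m : ℕ} (hm : m < n) :
    (Finset.univ.filter (fun v : Fin n => (v : ℕ) < m + 1 ∧ f v < x)).card =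
      (Finset.univ.filter (fun v : Fin n => (v : ℕ) < m ∧ f v < x)).card +
        if f ⟨m, hm⟩ < x then 1 else 0 := by
  split_ifs with h
  · rw [← Finset.card_insert_of_notMem (a := (⟨m, hm⟩ : Fin n)) (by simp)]
    congr 1
    ext v
    simp only [Finset.mem_filter, Finset.mem_univ, true_and, Finset.mem_insert, Fin.ext_iff]
    constructor
    · rintro ⟨h1, h2⟩
      by_cases h3 : (v : ℕ) = m
      · exact .inl h3
      · exact .inr ⟨by lia, h2⟩
    · rintro (h1 | ⟨h1, h2⟩)
      · have : v = ⟨m, hm⟩ := Fin.ext h1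
        subst this
        exact ⟨by simp, h⟩
      · exact ⟨by lia, h2⟩
  · rw [add_zero]
    congr 1
    ext v
    simp only [Finset.mem_filter, Finset.mem_univ, true_and]
    refine and_congr_left fun h2 => ⟨fun h1 => ?_, fun h1 => by lia⟩
    by_contra h3
    have : v = ⟨m, hm⟩ := Fin.ext (by simp; lia)
    subst this
    exact h h2

theorem term_sortProgram {f : Fin n → ℝ} {l : List (Fin n)} {a s : ℕ} {σ : Store}
    (hs : s = 10 ∨ s = 11) (hn : σ.nat 0 0 = n) (hf : HoldsFun a f σ)
    (hl : l.Pairwise (fun u v => f u < f v)) (hmem : ∀ u, u ∈ l) :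
    Term (sortProgram a s) σ (100 * (n + 1) ^ 2) (HoldsList s l) := by
  have hnd : l.Nodup := hl.imp fun h => by rintro rfl; exact lt_irrefl _ h
  let Inv : ℕ → Store → Prop := fun m τ => τ.nat 12 0 = m ∧ τ.nat 0 0 = n ∧ HoldsFun a f τ ∧
    ∀ i (h : i < l.length), (l[i] : ℕ) < m → τ.nat s i = l[i]
  refine (term_forLoop (Inv := Inv) (N := n) (c := 60 * (n + 1)) (fun m τ h => ⟨h.1, h.2.1⟩)
    ?_ ?_).mono (by ring_nf; lia) ?_
  · rintro m hm τ ⟨h12, h0, hf, h⟩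
    let Inv' : ℕ → Store → Prop := fun k ρ => ρ.nat 13 0 = k ∧ ρ.nat 0 0 = n ∧ HoldsFun a f ρ ∧
      ρ.nat 12 0 = m ∧ ρ.nat 14 0 =
        (Finset.univ.filter (fun v : Fin n => (v : ℕ) < k ∧ f v < f ⟨m, hm⟩)).card
    have h1 : Term (.setNat 14 (.lit 0) (.lit 0)) τ 5 (fun ρ => ρ = τ.writeNat 14 0 0) :=
      term_exec rfl (by simp [Program.bound, NatExp.cost]) rfl
    have h2 : Term (forLoop 13 0 <| .ite (.realLt (.get a (var 13)) (.get a (var 12)))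
        (.setNat 14 (.lit 0) (.succ (var 14))) .skip) (τ.writeNat 14 0 0) ((20 + 11) * (n + 1))
        (Inv' n) := by
      refine term_forLoop (Inv := Inv') (N := n) (fun m τ h => ⟨h.1, h.2.1⟩) ?_ ?_
      · rintro k hk ρ ⟨h13, h0, hf, h12, h14⟩
        refine term_exec rfl (by simp [Program.bound, NatExp.cost, RealExp.cost, Test.cost]) ?_
        have e1 := hf ⟨k, hk⟩
        have e2 := hf ⟨m, hm⟩
        simp only at e1 e2
        simp only [Inv', Program.exec, Test.Holds, RealExp.eval, NatExp.eval, h13, h12, e1, e2,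
          card_lt_succ hk, h14]
        split_ifs with hlt
        · simp [writeNat_nat, h13, h0, h12]
          exact hf
        · simp [writeNat_nat, h13, h0, h12, h14]
          exact hf
      · refine ⟨by simp [writeNat_nat], by simp [writeNat_nat, h0], hf,
          by simp [writeNat_nat, h12], by simp [writeNat_nat]⟩
    have h3 := ((h1.seq (by rintro _ rfl; exact h2)).frame [14, 13] [] rfl).seq
      (P' := .setNat s (var 14) (var 12)) (c' := 10)
      (Q' := fun ρ => ρ.nat 12 0 = m ∧ Inv (m + 1) (ρ.writeNat 12 0 (m + 1))) ?_
    · exact h3.mono (by lia) (fun _ h => h)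
    rintro ρ ⟨⟨h13, h0', hf', h12', h14⟩, hfr⟩
    refine term_exec rfl (by simp [Program.bound, NatExp.cost]) ?_
    have hsf : s ∉ [14, 13] ∧ s ≠ 12 ∧ s ≠ 0 := by rcases hs with rfl | rfl <;> simp
    have hsf' : 12 ≠ s ∧ 0 ≠ s := ⟨hsf.2.1.symm, hsf.2.2.symm⟩
    simp only [Fin.is_lt, true_and] at h14
    simp only [Inv, Program.exec, NatExp.eval, writeNat_nat, hsf, hsf', if_false, if_true, h12',
      Function.update_self, h14, hfr.1 s hsf.1]
    refine ⟨trivial, trivial, by simpa using h0', hf', fun i hi him => ?_⟩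
    obtain ⟨k, hk, hkm⟩ := List.getElem_of_mem (hmem ⟨m, hm⟩)
    have hc := card_lt_getElem hl hmem hk
    rw [hkm] at hc
    rw [hc]
    -- Distinct points have distinct ranks, so the new entry overwrites none of the earlier ones.
    by_cases hik : i = k
    · subst hik
      simp [hkm]
    · rw [Function.update_of_ne hik]
      refine h i hi (lt_of_le_of_ne (Nat.lt_succ_iff.1 him) fun he => hik ?_)
      have : l[i] = l[k] := by rw [hkm]; exact Fin.ext he
      exact (hnd.getElem_inj_iff).1 this
  · exact ⟨by simp [writeNat_nat], by simp [writeNat_nat, hn], hf, by simp⟩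
  · rintro τ ⟨-, -, -, h⟩
    exact fun i hi => h i hi (Fin.is_lt _)

/-! ### The dynamic program over the position of the second apex -/

/-- The coordinates, the projections and the sorted list of the points are in place. -/
structure Ready (p : Fin n → Plane) (Y : Fin n → ℝ) (l : List (Fin n)) (σ : Store) : Prop where
  coord : Coord p σ
  fn : HoldsFun 4 Y σ
  list : HoldsList 10 l σ
  reverse : HoldsList 11 l.reverse σ

theorem Ready.frame {p : Fin n → Plane} {Y : Fin n → ℝ} {l : List (Fin n)} {M R : List ℕ}
    {σ τ : Store} (h : Ready p Y l σ) (hf : Frame M R σ τ) (hM : 0 ∉ M ∧ 10 ∉ M ∧ 11 ∉ M)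
    (hR : 0 ∉ R ∧ 1 ∉ R ∧ 4 ∉ R) : Ready p Y l τ :=
  ⟨h.coord.frame hf hM.1 ⟨hR.1, hR.2.1⟩, h.fn.frame hf hR.2.2, h.list.frame hf hM.2.1,
    h.reverse.frame hf hM.2.2⟩

/-- Extend the tree under construction by legs, and update the register `r` if this succeeds. -/
def legPick (s c : ℕ) (r : Reg) : Program :=
  .seq (legProgram s c) (.ite (.natLt (.lit 0) (var 18)) (pickReg regTree r) .skip)

/-- `S'` is the set of trees that become available with these legs: empty if the legs fail, and
otherwise with `E ++ F` as a shortest element. -/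
theorem term_legPick {p : Fin n → Plane} {Y : Fin n → ℝ} {D E : List (Fin n × Fin n)}
    {l : List (Fin n)} {s c : ℕ} {r : Reg} {σ : Store} {i : ℕ} (hi : i < l.length)
    (hs : s = 10 ∨ s = 11) (hc : c = 20 ∨ c = 21) (hci : σ.nat c 0 = i)
    (hp : Coord p σ) (hY : HoldsFun 4 Y σ) (hl : HoldsList s l σ) (hE : regTree.Holds p E σ)
    (hr : r = regHalf ∨ r = regOut) (hD : r.Holds p D σ) {S S' : Set (List (Fin n × Fin n))}
    (hS : Best p S D)
    (hS' : ∀ F, leg Y (l.take i).reverse l[i] l[i] = some F →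
      E ++ F ∈ S' ∧ ∀ G ∈ S', listLength p (E ++ F) ≤ listLength p G)
    (hS'' : leg Y (l.take i).reverse l[i] l[i] = none → S' = ∅) {m : ℕ}
    (hm : ∀ F ∈ S ∪ S', F.length = m) :
    Term (legPick s c r) σ (200 * (i + 1) + (10 + 60 * (m + 1)))
      (fun τ => ∃ D', r.Holds p D' τ ∧ Best p (S ∪ S') D') := by
  have h1 := (term_legProgram hi hs hc hci hp hY hl hE).frame [7, 8, 9, 15, 16, 17, 18, 22] [8] rfl
  refine h1.seq ?_
  rintro τ ⟨h2, f⟩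
  have hD' : r.Holds p D τ :=
    hD.frame f (by rcases hr with rfl | rfl <;> simp [regHalf, regOut, Reg.Free])
  refine (Term.ite (c := 60 * (m + 1)) (fun hb => ?_) (fun hb => ?_)).mono
    (by simp [Test.cost, NatExp.cost]) (fun _ h => h)
  · simp only [Test.Holds, NatExp.eval] at hb
    rcases h2 with ⟨-, F, hF, hEF⟩ | ⟨h18, -⟩
    · exact term_pickReg (by rcases hr with rfl | rfl <;> simp [regHalf, regOut, regTree]) hEF hD'
        hS (hS' F hF) hm
    · rw [h18] at hb; exact absurd hb (lt_irrefl _)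
  · simp only [Test.Holds, NatExp.eval] at hb
    rcases h2 with ⟨h18, -⟩ | ⟨-, hnone⟩
    · rw [h18] at hb; exact absurd Nat.one_pos hb
    · refine term_exec rfl (by simp [Program.bound]; lia) ⟨D, hD', ?_⟩
      rwa [hS'' hnone, Set.union_empty]

/-- The half trees that end with an edge from the head of `m` to `c`. -/
def extSet (Y : Fin n → ℝ) (m : List (Fin n)) (c : Fin n) : Set (List (Fin n × Fin n)) :=
  {E | ∃ a t E₀, m = a :: t ∧ Half Y (a :: t) E₀ ∧ E = E₀ ++ [(a, c)]}

theorem half_cons (Y : Fin n → ℝ) (m : List (Fin n)) (c : Fin n) :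
    {E | Half Y (c :: m) E} = extSet Y m c ∪ {E | leg Y m c c = some E} := by
  ext E
  constructor
  · intro h
    rcases h with h | h
    · exact .inr h
    · exact .inl ⟨_, _, _, rfl, h, rfl⟩
  · rintro (⟨a, t, E₀, rfl, h, rfl⟩ | h)
    · exact .ext h
    · exact .leg h

/-- The candidate trees in which the second pair of legs starts at position `j < k` of `l`. -/
def candSet (Y : Fin n → ℝ) (l : List (Fin n)) (k : ℕ) : Set (List (Fin n × Fin n)) :=
  {E | ∃ j, ∃ h : j < l.length, j < k ∧ ∃ E₁ F, Half Y (l[j] :: (l.take j).reverse) E₁ ∧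
    leg Y (l.drop (j + 1)) l[j] l[j] = some F ∧ E = E₁ ++ F}

theorem candSet_zero (Y : Fin n → ℝ) (l : List (Fin n)) : candSet Y l 0 = ∅ := by
  ext E; simp [candSet]

theorem candSet_succ (Y : Fin n → ℝ) (l : List (Fin n)) {k : ℕ} (hk : k < l.length) :
    candSet Y l (k + 1) = candSet Y l k ∪ {E | ∃ E₁ F, Half Y (l[k] :: (l.take k).reverse) E₁ ∧
      leg Y (l.drop (k + 1)) l[k] l[k] = some F ∧ E = E₁ ++ F} := by
  ext E
  constructor
  · rintro ⟨j, h, hj, h'⟩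
    rcases Nat.lt_succ_iff_lt_or_eq.1 hj with hj | rfl
    · exact .inl ⟨j, h, hj, h'⟩
    · exact .inr h'
  · rintro (⟨j, h, hj, h'⟩ | h')
    · exact ⟨j, h, by lia, h'⟩
    · exact ⟨k, hk, by lia, h'⟩

theorem candSet_length (Y : Fin n → ℝ) (l : List (Fin n)) :
    candSet Y l l.length = {E | Cand Y l E} := by
  ext E
  constructor
  · rintro ⟨j, h, -, E₁, F, h1, h2, rfl⟩
    refine ⟨_, _, _, E₁, F, ?_, h1, h2, rfl⟩
    simp
  · rintro ⟨l₁, c, r, E₁, F, rfl, h1, h2, rfl⟩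
    refine ⟨l₁.length, by simp, by simp, E₁, F, ?_, ?_, rfl⟩
    · have : (l₁.reverse ++ c :: r).take l₁.length = l₁.reverse :=
        List.take_left' (by simp)
      simpa [this, List.getElem_append_right] using h1
    · have : (l₁.reverse ++ c :: r).drop (l₁.length + 1) = r := by
        rw [← List.drop_drop, List.drop_left' (by simp)]; rfl
      simpa [this, List.getElem_append_right] using h2

/-- Extend the half tree by the edge that leads to the current point. -/
def extendHalf : Program :=
  .ite (.natLt (.lit 0) (var 20))
    (appendEdge regHalf (.get 10 (.pred (var 20))) (.get 10 (var 20))) .skip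

theorem term_extendHalf {p : Fin n → Plane} {Y : Fin n → ℝ} {D : List (Fin n × Fin n)}
    {l : List (Fin n)} {σ : Store} {j : ℕ} (hj : j < l.length) (h20 : σ.nat 20 0 = j)
    (hp : Coord p σ) (hl : HoldsList 10 l σ) (hD : regHalf.Holds p D σ)
    (hS : Best p {E | Half Y (l.take j).reverse E} D) :
    Term extendHalf σ 100 (fun τ => ∃ D', regHalf.Holds p D' τ ∧
      Best p (extSet Y (l.take j).reverse l[j]) D') := by
  refine (Term.ite (c := 80) (fun hb => ?_) (fun hb => ?_)).mono
    (by simp [Test.cost, NatExp.cost]) (fun _ h => h)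
  · simp only [Test.Holds, NatExp.eval, h20] at hb
    obtain ⟨k, rfl⟩ : ∃ k, j = k + 1 := ⟨j - 1, by lia⟩
    have hk : k < l.length := by lia
    have htake : (l.take (k + 1)).reverse = l[k] :: (l.take k).reverse := by
      rw [List.take_add_one, List.getElem?_eq_getElem hk]; simp
    refine (term_appendEdge (a := l[k]) (b := l[k + 1]) (by simp [regHalf]) hp hD ?_ ?_).mono
      (by simp [NatExp.cost]) (fun τ hτ => ⟨_, hτ, .inl ?_⟩)
    · intro τ hτ
      simp only [NatExp.eval]
      rw [hτ.1 20 (by simp [regHalf]), h20, hτ.1 10 (by simp [regHalf])]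
      exact hl k hk
    · intro τ hτ
      simp only [NatExp.eval]
      rw [hτ.1 20 (by simp [regHalf]), h20, hτ.1 10 (by simp [regHalf])]
      exact hl _ hj
    · rw [htake] at hS ⊢
      rcases hS with ⟨h1, h2⟩ | ⟨h1, -⟩
      -- The same edge is added to every half tree, so a shortest one stays shortest.
      · refine ⟨⟨_, _, _, rfl, h1, rfl⟩, ?_⟩
        rintro E ⟨a, t, E₀, he, hE, rfl⟩
        obtain ⟨rfl, rfl⟩ := List.cons_eq_cons.1 he
        rw [listLength_append, listLength_append]
        exact add_le_add_left (h2 E₀ hE) _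
      · obtain ⟨E, hE⟩ := Half.nonempty (Y := Y) (l.take k).reverse l[k]
        exact (Set.eq_empty_iff_forall_notMem.1 h1 E hE).elim
  · simp only [Test.Holds, NatExp.eval, h20] at hb
    have : j = 0 := by lia
    subst this
    refine term_exec rfl (by simp [Program.bound]) ⟨D, hD, .inr ⟨?_, ?_⟩⟩
    · ext E; simp [extSet]
    · rcases hS with ⟨h1, -⟩ | ⟨-, h1⟩
      · simp only [List.take_zero, List.reverse_nil, Set.mem_ofPred_eq] at h1
        nomatch h1
      · exact h1

/-- Empty the register. -/
def clearReg (r : Reg) : Program :=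
  .seq (.setNat r.card (.lit 0) (.lit 0)) (.setReal r.cost (.lit 0) (.lit 0))

theorem term_clearReg (r : Reg) (p : Fin n → Plane) (σ : Store) :
    Term (clearReg r) σ 10 (r.Holds p []) := by
  refine term_exec rfl (by simp [clearReg, Program.bound, NatExp.cost, RealExp.cost]) ?_
  simp [clearReg, Program.exec, Reg.Holds, writeNat_nat, writeReal_nat, writeReal_real,
    NatExp.eval, RealExp.eval, listLength]

/-- Find the shortest trees with the second pair of legs at the current point. -/
def treeStep : Program :=
  .seq (.setNat 21 (.lit 0) (.pred (var 21))) <| .seq extendHalf <| .seq (clearReg regTree) <|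
  .seq (legPick 10 20 regHalf) <| .seq (copyReg regHalf regTree) (legPick 11 21 regOut)

/-- The invariant of the loop over the points in their order. -/
def TreeInv (p : Fin n → Plane) (Y : Fin n → ℝ) (l : List (Fin n))
    (S : Set (List (Fin n × Fin n))) (j : ℕ) (σ : Store) : Prop :=
  σ.nat 20 0 = j ∧ σ.nat 21 0 = n - j ∧ Ready p Y l σ ∧
    (∃ D, regHalf.Holds p D σ ∧ Best p {E | Half Y (l.take j).reverse E} D) ∧
    ∃ O, regOut.Holds p O σ ∧ Best p (S ∪ candSet Y l j) O

/-- `S` collects the trees considered before this loop. The step turns a shortest half tree on the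
first `j` points into one on the first `j + 1` points, completes it by the legs on the other side,
and compares the result with the best tree so far; each part is linear in `n`. -/
theorem term_treeStep {p : Fin n → Plane} {Y : Fin n → ℝ} {l : List (Fin n)}
    {S : Set (List (Fin n × Fin n))} {j : ℕ} {σ : Store} (hn : l.length = n) (hj : j < n)
    (hS : ∀ E ∈ S, E.length = n - 1) (h : TreeInv p Y l S j σ) :
    Term treeStep σ (1000 * (n + 1)) (fun τ => τ.nat 20 0 = j ∧
      TreeInv p Y l S (j + 1) (τ.writeNat 20 0 (j + 1))) := by
  obtain ⟨h20, h21, hR, ⟨D, hD, hDb⟩, O, hO, hOb⟩ := h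
  have hjl : j < l.length := by lia
  have htake : (l.take (j + 1)).reverse = l[j] :: (l.take j).reverse := by
    rw [List.take_add_one, List.getElem?_eq_getElem hjl]; simp
  have hlenH : ∀ E, Half Y (l[j] :: (l.take j).reverse) E → E.length = j := fun E hE => by
    rw [hE.length, List.length_reverse, List.length_take]; lia
  have s1 : Term (.setNat 21 (.lit 0) (.pred (var 21))) σ 10 (fun τ => τ.nat 21 0 = n - 1 - j) := by
    refine term_exec rfl (by simp [Program.bound, NatExp.cost]) ?_
    simp [Program.exec, writeNat_nat, NatExp.eval, h21]
    lia
  refine Term.mono (c := 10 + (100 + (10 + ((200 * (j + 1) + (10 + 60 * (j + 1))) +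
    (40 * (j + 1) + (200 * (n - 1 - j + 1) + (10 + 60 * (n - 1 + 1)))))))) ?_ (by lia)
    (fun _ h => h)
  refine (s1.frame [21] [] rfl).seq ?_
  rintro τ₁ ⟨h21, f⟩
  replace hR := hR.frame f (by simp) (by simp)
  replace hD := hD.frame f (by simp [Reg.Free, regHalf])
  replace hO := hO.frame f (by simp [Reg.Free, regOut])
  replace h20 : τ₁.nat 20 0 = j := by rw [f.1 20 (by simp), h20]
  clear f
  refine ((term_extendHalf hjl h20 hR.coord hR.list hD hDb).frame [4, 5, 6] [7] rfl).seq ?_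
  rintro τ₂ ⟨⟨D', hD', hDb'⟩, f⟩
  replace hR := hR.frame f (by simp) (by simp)
  replace hO := hO.frame f (by simp [Reg.Free, regOut])
  replace h20 : τ₂.nat 20 0 = j := by rw [f.1 20 (by simp), h20]
  replace h21 : τ₂.nat 21 0 = n - 1 - j := by rw [f.1 21 (by simp), h21]
  clear f
  refine ((term_clearReg regTree p τ₂).frame [9] [8] rfl).seq ?_
  rintro τ₃ ⟨hT, f⟩
  replace hR := hR.frame f (by simp) (by simp)
  replace hD' := hD'.frame f (by simp [Reg.Free, regHalf])
  replace hO := hO.frame f (by simp [Reg.Free, regOut])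
  replace h20 : τ₃.nat 20 0 = j := by rw [f.1 20 (by simp), h20]
  replace h21 : τ₃.nat 21 0 = n - 1 - j := by rw [f.1 21 (by simp), h21]
  clear f
  refine ((term_legPick (S' := {E | leg Y (l.take j).reverse l[j] l[j] = some E}) (m := j) hjl
    (.inl rfl) (.inl rfl) h20 hR.coord hR.fn hR.list hT (.inl rfl) hD' hDb' ?_ ?_ ?_).frame
    [4, 5, 6, 7, 8, 9, 15, 16, 17, 18, 19, 22] [7, 8] rfl).seq ?_
  · intro F hF
    refine ⟨hF, fun G hG => ?_⟩
    rw [Set.mem_ofPred_eq, hF, Option.some.injEq] at hG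
    rw [hG, List.nil_append]
  · intro hnone
    ext E
    simp [hnone]
  · rw [← half_cons]
    exact hlenH
  rintro τ₄ ⟨⟨B, hB, hBb⟩, f⟩
  rw [← half_cons] at hBb
  replace hR := hR.frame f (by simp) (by simp)
  replace hO := hO.frame f (by simp [Reg.Free, regOut])
  replace h20 : τ₄.nat 20 0 = j := by rw [f.1 20 (by simp), h20]
  replace h21 : τ₄.nat 21 0 = n - 1 - j := by rw [f.1 21 (by simp), h21]
  clear f
  -- A half tree always exists, for instance a bare path, so the register now holds a true minimum.
  replace hBb := hBb.resolve_right fun h => by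
    obtain ⟨E, hE⟩ := Half.nonempty (Y := Y) (l.take j).reverse l[j]
    exact (Set.eq_empty_iff_forall_notMem.1 h.1 E hE).elim
  have hcopy := (term_copyReg (r := regHalf) (s := regTree) (by simp [regHalf, regTree]) hB).frame
    [7, 8, 9, 19] [8] rfl
  rw [hlenH B hBb.1] at hcopy
  refine hcopy.seq ?_
  rintro τ₅ ⟨hBT, f⟩
  replace hR := hR.frame f (by simp) (by simp)
  replace hO := hO.frame f (by simp [Reg.Free, regOut])
  replace hB := hB.frame f (by simp [Reg.Free, regHalf])
  replace h20 : τ₅.nat 20 0 = j := by rw [f.1 20 (by simp), h20]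
  replace h21 : τ₅.nat 21 0 = n - 1 - j := by rw [f.1 21 (by simp), h21]
  clear f
  -- Position `j` of `l` is position `n - 1 - j` of the reversed list. Reading that list backwards
  -- from there lists the points after `l[j]` in the order of `l`, so the same leg program serves
  -- both sides.
  have hrev : ∀ h : n - 1 - j < l.reverse.length, l.reverse[n - 1 - j] = l[j] := by
    intro h
    rw [List.getElem_reverse]
    congr 1
    lia
  have hrev' : (l.reverse.take (n - 1 - j)).reverse = l.drop (j + 1) := by
    rw [List.take_reverse, List.reverse_reverse]
    congr 1
    lia
  have hrl : n - 1 - j < l.reverse.length := by rw [List.length_reverse]; lia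
  refine ((term_legPick (S' := {E | ∃ E₁ F, Half Y (l[j] :: (l.take j).reverse) E₁ ∧
      leg Y (l.drop (j + 1)) l[j] l[j] = some F ∧ E = E₁ ++ F}) (m := n - 1) hrl
    (.inr rfl) (.inr rfl) h21 hR.coord hR.fn hR.reverse hBT (.inr rfl) hO hOb ?_ ?_ ?_).frame
    [1, 2, 3, 7, 8, 9, 15, 16, 17, 18, 19, 22] [6, 8] rfl).mono le_rfl ?_
  · intro F hF
    rw [hrev', hrev] at hF
    refine ⟨⟨B, F, hBb.1, hF, rfl⟩, ?_⟩
    rintro G ⟨E₁, F', h1, h2, rfl⟩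
    rw [hF, Option.some.injEq] at h2
    rw [← h2, listLength_append, listLength_append]
    -- The legs `F` are determined by the position, so only the half tree has to be minimized.
    exact add_le_add_left (hBb.2 E₁ h1) _
  · intro hnone
    rw [hrev', hrev] at hnone
    ext E
    simp [hnone]
  · rw [Set.union_assoc, ← candSet_succ Y l hjl]
    rintro F (hF | ⟨i, hi, -, E₁, F, h1, h2, rfl⟩)
    · exact hS F hF
    · rw [List.length_append, h1.length, leg_length h2, List.length_reverse, List.length_take,
        List.length_drop]
      lia
  rintro τ₆ ⟨⟨O', hO', hOb'⟩, f⟩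
  rw [Set.union_assoc, ← candSet_succ Y l hjl] at hOb'
  replace hR := hR.frame f (by simp) (by simp)
  replace hB := hB.frame f (by simp [Reg.Free, regHalf])
  replace h20 : τ₆.nat 20 0 = j := by rw [f.1 20 (by simp), h20]
  replace h21 : τ₆.nat 21 0 = n - 1 - j := by rw [f.1 21 (by simp), h21]
  clear f
  have f := (Frame.refl [20] [] τ₆).writeNat (a := 20) (by simp) 0 (j + 1)
  refine ⟨h20, by simp [writeNat_nat], ?_, hR.frame f (by simp) (by simp),
    ⟨B, hB.frame f (by simp [Reg.Free, regHalf]), .inl ?_⟩,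
    O', hO'.frame f (by simp [Reg.Free, regOut]), hOb'⟩
  · rw [f.1 21 (by simp), h21]
    lia
  · rw [htake]
    exact hBb

/-- Find a shortest candidate tree, for one direction. -/
def treeLoop : Program :=
  .seq (.seq (clearReg regHalf) (.setNat 21 (.lit 0) (var 0))) (forLoop 20 0 treeStep)

theorem term_treeLoop {p : Fin n → Plane} {Y : Fin n → ℝ} {l : List (Fin n)}
    {S : Set (List (Fin n × Fin n))} {σ : Store} {O : List (Fin n × Fin n)} (hn : l.length = n)
    (hS : ∀ E ∈ S, E.length = n - 1) (hR : Ready p Y l σ) (hO : regOut.Holds p O σ)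
    (hOb : Best p S O) :
    Term treeLoop σ (1100 * (n + 1) ^ 2) (fun τ => ∃ O', regOut.Holds p O' τ ∧
      Best p (S ∪ {E | Cand Y l E}) O') := by
  have s1 := ((term_clearReg regHalf p σ).frame [6] [7] rfl).seq (P' := .setNat 21 (.lit 0) (var 0))
    (c' := 10) (Q' := fun τ => (regHalf.Holds p [] τ ∧ τ.nat 21 0 = n)) (by
      rintro τ ⟨h, f⟩
      refine term_exec rfl (by simp [Program.bound, NatExp.cost]) ⟨?_, ?_⟩
      · exact h.frame ((Frame.refl [21] [] _).writeNat (by simp) _ _) (by simp [Reg.Free, regHalf])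
      · simp [Program.exec, writeNat_nat, NatExp.eval, (hR.coord.frame f (by simp) (by simp)).card])
  refine ((s1.frame [6, 21] [7] rfl).seq (c' := (1000 * (n + 1) + 11) * (n + 1)) ?_).mono
    (by ring_nf; lia) (fun _ h => h)
  rintro τ ⟨⟨hH, h21⟩, f⟩
  refine (term_forLoop (Inv := TreeInv p Y l S) (N := n)
    (fun k σ h => ⟨h.1, h.2.2.1.coord.card⟩)
    (fun k hk σ h => term_treeStep hn hk hS h) ?_).mono le_rfl ?_
  · have f' := (Frame.refl [20] [] τ).writeNat (a := 20) (by simp) 0 0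
    refine ⟨by simp [writeNat_nat], by rw [f'.1 21 (by simp), h21]; rfl,
      (hR.frame f (by simp) (by simp)).frame f' (by simp) (by simp),
      ⟨[], hH.frame f' (by simp [Reg.Free, regHalf]), .inr ⟨?_, rfl⟩⟩, O,
      (hO.frame f (by simp [Reg.Free, regOut])).frame f' (by simp [Reg.Free, regOut]), ?_⟩
    · ext E
      simp only [List.take_zero, List.reverse_nil, Set.mem_ofPred_eq, Set.mem_empty_iff_false,
        iff_false]
      exact fun h => nomatch h
    · rwa [candSet_zero, Set.union_empty]
  · rintro ρ ⟨-, -, -, -, O', hO', hOb'⟩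
    have hc := candSet_length Y l
    rw [hn] at hc
    rw [hc] at hOb'
    exact ⟨O', hO', hOb'⟩

/-! ### One phase for each direction, and the final result -/

/-- Find a shortest tree among the output and the candidate trees for the direction that starts in
cell `i` of the array of directions; the other direction starts in cell `k`. -/
def phase (i k : ℕ) : Program :=
  .seq (project i k) <| .seq (sortProgram 3 10) <| .seq (sortProgram 5 11) treeLoop

theorem term_phase {p : Fin n → Plane} {d d' : Plane} {i k : ℕ} {σ : Store} (hp : Coord p σ)
    (hd : σ.real 2 i = d 0 ∧ σ.real 2 (i + 1) = d 1)
    (hd' : σ.real 2 k = d' 0 ∧ σ.real 2 (k + 1) = d' 1) {l : List (Fin n)}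
    (hl : l.Pairwise (fun u v => (inner ℝ d (p u) : ℝ) < inner ℝ d (p v)))
    (hmem : ∀ u, u ∈ l) (hn : l.length = n) {S : Set (List (Fin n × Fin n))}
    {O : List (Fin n × Fin n)} (hS : ∀ E ∈ S, E.length = n - 1) (hO : regOut.Holds p O σ)
    (hOb : Best p S O) :
    Term (phase i k) σ (1500 * (n + 1) ^ 2) (fun τ => ∃ O', regOut.Holds p O' τ ∧
      Best p (S ∪ {E | Cand (fun u => inner ℝ d' (p u)) l E}) O') := by
  refine Term.mono (c := 80 * (n + 1) + (100 * (n + 1) ^ 2 + (100 * (n + 1) ^ 2 +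
    1100 * (n + 1) ^ 2))) ?_ (by ring_nf; lia) (fun _ h => h)
  refine ((term_project hp hd hd').frame [12] [3, 4, 5] rfl).seq ?_
  rintro τ₁ ⟨⟨h3, h4, h5⟩, f⟩
  replace hp := hp.frame f (by simp) (by simp)
  replace hO := hO.frame f (by simp [Reg.Free, regOut])
  clear f
  refine ((term_sortProgram (.inl rfl) hp.card h3 hl hmem).frame [10, 12, 13, 14] [] rfl).seq ?_
  rintro τ₂ ⟨h10, f⟩
  replace hp := hp.frame f (by simp) (by simp)
  replace hO := hO.frame f (by simp [Reg.Free, regOut])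
  replace h4 := h4.frame f (by simp)
  replace h5 := h5.frame f (by simp)
  clear f
  refine ((term_sortProgram (l := l.reverse) (.inr rfl) hp.card h5
    (by simpa [List.pairwise_reverse] using hl) (by simpa using hmem)).frame
    [11, 12, 13, 14] [] rfl).seq ?_
  rintro τ₃ ⟨h11, f⟩
  exact term_treeLoop hn hS ⟨hp.frame f (by simp) (by simp), h4.frame f (by simp),
    h10.frame f (by simp), h11⟩ (hO.frame f (by simp [Reg.Free, regOut])) hOb

theorem exists_sorted {f : Fin n → ℝ} (hf : Function.Injective f) :
    ∃ l : List (Fin n), l.Pairwise (fun u v => f u < f v) ∧ (∀ u, u ∈ l) ∧ l.length = n := by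
  refine ⟨List.ofFn (Tuple.sort f), ?_, fun u => ?_, by simp⟩
  · rw [List.pairwise_ofFn]
    intro i j hij
    have := Tuple.monotone_sort f hij.le
    exact lt_of_le_of_ne this fun h => hij.ne ((Tuple.sort f).injective (hf h))
  · rw [List.mem_ofFn]
    exact (Tuple.sort f).surjective u

theorem GeneralPosition.injective {V : Type*} {p : V → Plane} {d : Plane}
    (h : GeneralPosition p d) : Function.Injective fun v => (inner ℝ d (p v) : ℝ) := by
  intro u v huv
  by_contra hne
  refine h u v hne ?_
  rw [inner_sub_right]
  exact sub_eq_zero.2 huv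

theorem outputGraph_eq {p : Fin n → Plane} {E : List (Fin n × Fin n)} {τ : Store}
    (hE : regOut.Holds p E τ) (hn : E.length = n - 1) : outputGraph n τ = listGraph E := by
  have : ∀ u v : Fin n, (∃ k < n - 1, τ.nat 1 k = (u : ℕ) ∧ τ.nat 2 k = (v : ℕ)) ↔ (u, v) ∈ E := by
    intro u v
    rw [List.mem_iff_getElem]
    constructor
    · rintro ⟨k, hk, h1, h2⟩
      have hk' : k < E.length := by lia
      obtain ⟨h3, h4⟩ := hE.2.2 k hk'
      exact ⟨k, hk', Prod.ext (Fin.ext (h3.symm.trans h1)) (Fin.ext (h4.symm.trans h2))⟩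
    · rintro ⟨k, hk, h⟩
      obtain ⟨h3, h4⟩ := hE.2.2 k hk
      rw [h] at h3 h4
      exact ⟨k, by lia, h3, h4⟩
  rw [outputGraph, listGraph]
  simp only [this]

end MonotoneTree

theorem mainTheorem5 :
    ∃ (P : RealRAM.Program) (C : ℕ),
      ∀ (n : ℕ), 1 ≤ n → ∀ (p : Fin n → Plane) (d₁ d₂ : Plane),
        Function.Injective p →
        MonotoneTree.IsDirection d₁ → MonotoneTree.IsDirection d₂ →
        d₁ ≠ d₂ → d₁ ≠ -d₂ →
        MonotoneTree.GeneralPosition p d₁ → MonotoneTree.GeneralPosition p d₂ →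
        ∃ (τ : RealRAM.Store) (t : ℕ),
          RealRAM.Runs P (MonotoneTree.inputStore p d₁ d₂) τ t ∧
          t ≤ C * n ^ 2 ∧
          MonotoneTree.IsMinimumMonotoneSpanningTree p {d₁, d₂}
            (MonotoneTree.outputGraph n τ) := by
  -- Two phases of at most `1500 * (n + 1) ^ 2` steps each, and `n + 1 ≤ 2 * n`.
  refine ⟨.seq (MonotoneTree.phase 0 2) (MonotoneTree.phase 2 0), 12000, ?_⟩
  intro n hn p d₁ d₂ _ _ _ _ _ h₁ h₂
  have hne : Nonempty (Fin n) := ⟨⟨0, hn⟩⟩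
  obtain ⟨l₁, hl₁, hm₁, hn₁⟩ := MonotoneTree.exists_sorted h₁.injective
  obtain ⟨l₂, hl₂, hm₂, hn₂⟩ := MonotoneTree.exists_sorted h₂.injective
  have hp : MonotoneTree.Coord p (MonotoneTree.inputStore p d₁ d₂) := by
    constructor <;> simp [MonotoneTree.inputStore]
  have hO : MonotoneTree.regOut.Holds p [] (MonotoneTree.inputStore p d₁ d₂) := by
    simp [MonotoneTree.Reg.Holds, MonotoneTree.regOut, MonotoneTree.inputStore,
      MonotoneTree.listLength]
  have e₁ : ∀ E ∈ (∅ : Set (List (Fin n × Fin n))) ∪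
      {E | MonotoneTree.Cand (fun u => inner ℝ d₂ (p u)) l₁ E}, E.length = n - 1 := by
    rintro E (hE | hE)
    · exact hE.elim
    · rw [hE.length, hn₁]
  have t₁ := (MonotoneTree.term_phase (i := 0) (k := 2) (d := d₁) (d' := d₂) (S := ∅) hp
    ⟨rfl, rfl⟩ ⟨rfl, rfl⟩ hl₁ hm₁ hn₁ (fun _ h => h.elim) hO (.inr ⟨rfl, rfl⟩)).frame
    [1, 2, 3, 4, 5, 6, 7, 8, 9, 10, 11, 12, 13, 14, 15, 16, 17, 18, 19, 20, 21, 22]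
    [3, 4, 5, 6, 7, 8] rfl
  obtain ⟨τ, t, hrun, ht, O, hO', hOb⟩ := t₁.seq (P' := MonotoneTree.phase 2 0) (by
    rintro τ ⟨⟨O, hO', hOb⟩, f⟩
    refine MonotoneTree.term_phase (d := d₂) (d' := d₁) (hp.frame f (by simp) (by simp))
      ?_ ?_ hl₂ hm₂ hn₂ e₁ hO' hOb
    · rw [f.2 2 (by simp)]; exact ⟨rfl, rfl⟩
    · rw [f.2 2 (by simp)]; exact ⟨rfl, rfl⟩)
  refine ⟨τ, t, hrun, ht.trans (by nlinarith), ?_⟩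
  rw [Set.empty_union] at hOb e₁
  -- The path through all points in sorted order is a candidate, so the set searched is not empty.
  have hOb' := hOb.resolve_right fun h => by
    obtain ⟨E, hE⟩ := MonotoneTree.Cand.nonempty (Y := fun u => inner ℝ d₂ (p u))
      (List.ne_nil_of_mem (hm₁ ⟨0, hn⟩))
    exact (Set.eq_empty_iff_forall_notMem.1 h.1 E (.inl hE)).elim
  have hlen : O.length = n - 1 := by
    rcases hOb'.1 with h | h
    · exact e₁ O h
    · rw [MonotoneTree.Cand.length h, hn₂]
  rw [MonotoneTree.outputGraph_eq hO' hlen]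
  exact MonotoneTree.isMinimumMonotoneSpanningTree_of_cand h₁.injective h₂.injective hl₁ hl₂ hm₁ hm₂
    hOb'.1 hOb'.2
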